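/- Let $R$ be a commutative ring and $n\ge 0$ an integer. Write $S=\mathbb{Z}_{\ge 0}^n\setminus\{0\}$, and for $J\in S$ let $\gcd(J)$ be the greatest common divisor of the non-zero entries of $J$. For a commutative ring $B$, let $\mathbb{W}_S(B)$ be the ring of $n$-dimensional Witt vectors of Angeltveit, Gerhardt, Hill and Lindenstrauss: its underlying set is $B^S$, and its ring structure is the unique one, functorial in $B$, for which the ghost map $\mathbb{W}_S(B)\to B^S$, $(r_I)_I\mapsto (w_I)_I$, with $$w_I=\sum_{kJ=I,\ k\ge 1,\ J\in S}\gcd(J)\,r_J^{\,k},$$ is a ring homomorphism. Formal schemes over $R$ are identified with their functors of points: a formal scheme over $R$ is a functor from commutative $R$-algebras to sets that is a small filtered colimit of affine $R$-schemes (representable functors); for a topological $R$-algebra $A$, $\operatorname{Spf}A$ is the functor that sends $B$ to the set of continuous $R$-algebra homomorphisms from $A$ to the discrete ring $B$. A commutative formal group over $R$ is a functor from commutative $R$-algebras to abelian groups whose underlying functor to sets is a formal scheme; it is pointed by its identity element. Let $\mathrm{Mor}_{\mathrm{fg}}$ denote the group of homomorphisms of commutative formal groups (natural transformations of group-valued functors),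 and for a pointed formal scheme $X$ and a commutative formal group $G$ let $\mathrm{Mor}_{\mathrm{fs}}(X,G)$ denote the group, under pointwise addition, of morphisms of pointed formal schemes over $R$ from $X$ to $G$. Let $\hat{\mathbb{A}}^n=\operatorname{Spf}R[[t_1,\dots,t_n]]$, pointed by the ideal $(t_1,\dots,t_n)$. Let $\hat{\mathbb{W}}_S$ be the additive formal group of $\mathbb{W}_S$ over $R$: its $B$-points are the elements $(r_I)_I$ of the additive group $\mathbb{W}_S(B)$ such that all $r_I$ are nilpotent and all but finitely many are zero. (Its underlying formal scheme is $\operatorname{Spf}R[[x_I: I\in S]]$, where the power series ring has the topology of coefficientwise convergence with $R$ discrete.) Theorem. Suppose that $R$ is a $\mathbb{Q}$-algebra or that $n=1$. Then $\hat{\mathbb{W}}_S$ represents the functor $G\mapsto \mathrm{Mor}_{\mathrm{fs}}(\hat{\mathbb{A}}^n,G)$ from commutative formal groups over $R$ to abelian groups; that is, there are group isomorphisms $$\mathrm{Mor}_{\mathrm{fg}}(\hat{\mathbb{W}}_S,G)\;\cong\;\mathrm{Mor}_{\mathrm{fs}}(\hat{\mathbb{A}}^n,G),$$ natural in the commutative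 formal group $G$ over $R$. (For $n=1$ this is Cartier's first theorem.) -/

import Mathlib

open CategoryTheory CategoryTheory.Limits

universe u

namespace MultiWitt

/-- The index set `ℤ_{≥0}^n - 0`. -/
def Idx (n : ℕ) : Type := {I : Fin n → ℕ // I ≠ 0}

namespace Idx

variable {n : ℕ}

/-- The greatest common divisor of the non-zero entries of `I` (entries that are zero do not
affect it). -/
def gcd (I : Idx n) : ℕ := Finset.univ.gcd I.1

/-- The total degree `i_1 + ... + i_n`. -/
def deg (I : Idx n) : ℕ := ∑ i, I.1 i

theorem gcd_pos (I : Idx n) : 0 < I.gcd := by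
  rw [Nat.pos_iff_ne_zero]
  intro h
  apply I.2
  funext i
  exact Finset.gcd_eq_zero_iff.1 h i (Finset.mem_univ i)

theorem deg_pos (I : Idx n) : 0 < I.deg := by
  rw [Nat.pos_iff_ne_zero]
  intro h
  apply I.2
  funext i
  exact Finset.sum_eq_zero_iff.1 h i (Finset.mem_univ i)

theorem finite_deg_le (n M : ℕ) : {I : Idx n | I.deg ≤ M}.Finite := by
  have h : ((fun I : Idx n => I.1) '' {I : Idx n | I.deg ≤ M}).Finite := by
    refine (Set.finite_Iic (fun _ : Fin n => M)).subset ?_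
    rintro _ ⟨I, hI, rfl⟩ i
    exact (Finset.single_le_sum (f := I.1) (fun _ _ => Nat.zero_le _) (Finset.mem_univ i)).trans hI
  exact h.of_finite_image (Subtype.val_injective.injOn)

end Idx

variable {n : ℕ}

/-- The pairs `(k, J)` with `k J = I` (then `k ≥ 1` automatically, because `I ≠ 0`). -/
def Factor (I : Idx n) : Type := {p : ℕ × Idx n // p.1 • p.2.1 = I.1}

namespace Factor

variable {I : Idx n}

/-- The multiplier `k` of a pair `(k, J)`. -/
def k (f : Factor I) : ℕ := f.1.1

/-- The index `J` of a pair `(k, J)`. -/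
def J (f : Factor I) : Idx n := f.1.2

theorem smul_eq (f : Factor I) : f.k • f.J.1 = I.1 := f.2

theorem k_pos (f : Factor I) : 0 < f.k := by
  rw [Nat.pos_iff_ne_zero]
  intro h
  apply I.2
  rw [← f.smul_eq, h, zero_smul]

theorem k_mul_gcd (f : Factor I) : f.k * f.J.gcd = I.gcd := by
  unfold Idx.gcd
  rw [← f.smul_eq]
  exact (Finset.gcd_mul_left (s := Finset.univ) (f := f.J.1) (a := f.k)).symm ▸ by simp

theorem k_mul_deg (f : Factor I) : f.k * f.J.deg = I.deg := by
  unfold Idx.deg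
  rw [← f.smul_eq, Finset.mul_sum]
  rfl

theorem k_injective : Function.Injective (k : Factor I → ℕ) := by
  intro f g h
  apply Subtype.ext
  refine Prod.ext h (Subtype.ext ?_)
  funext i
  have h1 := congrFun f.smul_eq i
  have h2 := congrFun g.smul_eq i
  rw [← h2] at h1
  rw [h] at h1
  exact Nat.eq_of_mul_eq_mul_left g.k_pos h1

instance : Finite (Factor I) := by
  have : Function.Injective (fun f : Factor I => (⟨f.k, by
      have := f.k_mul_gcd
      have h := f.J.gcd_pos
      have : f.k ≤ I.gcd := by nlinarith
      omega⟩ : Fin (I.gcd + 1))) := by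
    intro f g h
    exact k_injective (Fin.mk.inj_iff.1 h)
  exact Finite.of_injective _ this

noncomputable instance : Fintype (Factor I) := Fintype.ofFinite _

/-- The trivial pair `(1, I)`. -/
def triv (I : Idx n) : Factor I := ⟨(1, I), one_smul _ _⟩

theorem eq_triv {f : Factor I} (h : f.k = 1) : f = triv I := k_injective h

theorem gcd_lt {f : Factor I} (h : f.k ≠ 1) : f.J.gcd < I.gcd := by
  have h1 := f.k_mul_gcd
  have h2 := f.k_pos
  have h3 := f.J.gcd_pos
  have : 2 ≤ f.k := by omega
  nlinarith

end Factor

section Dwork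

variable {A : Type*} [CommRing A]

open Classical in
theorem sum_factor (I : Idx n) (F : Factor I → A) :
    ∑ f, F f = F (Factor.triv I) + ∑ f : {f : Factor I // f.k ≠ 1}, F f := by
  rw [← Finset.add_sum_erase _ _ (Finset.mem_univ (Factor.triv I))]
  congr 1
  refine (Finset.sum_subtype _ (fun f => ?_) _)
  simp only [Finset.mem_erase, Finset.mem_univ, and_true]
  exact ⟨fun h h' => h (Factor.eq_triv h'), fun h h' => h (h' ▸ rfl)⟩

theorem natCast_dvd_of_primes (g : ℕ) (hg : g ≠ 0) (x : A)
    (h : ∀ p : ℕ, p.Prime → p ∣ g → ((p : A) ^ g.factorization p) ∣ x) : (g : A) ∣ x := by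
  have h1 : (g : A) = ∏ p ∈ g.primeFactors, (p : A) ^ g.factorization p := by
    conv_lhs => rw [← Nat.prod_factorization_pow_eq_self hg]
    rw [Finsupp.prod]
    push_cast
    rfl
  rw [h1]
  refine Finset.prod_dvd_of_coprime ?_ ?_
  · intro p hp q hq hpq
    apply IsCoprime.pow
    have hc : Nat.Coprime p q := (Nat.coprime_primes (Nat.prime_of_mem_primeFactors hp)
      (Nat.prime_of_mem_primeFactors hq)).2 hpq
    have := (Nat.isCoprime_iff_coprime.2 hc).map (Int.castRingHom A)
    simpa using this
  · intro p hp
    exact h p (Nat.prime_of_mem_primeFactors hp) (Nat.dvd_of_mem_primeFactors hp)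

theorem pow_dvd_sub_pow {p m : ℕ} {a b : A} (h : (p : A) ∣ a - b) :
    (p : A) ^ (m.factorization p + 1) ∣ a ^ m - b ^ m := by
  obtain ⟨c, hc⟩ := Nat.ordProj_dvd m p
  have h1 := dvd_sub_pow_of_dvd_sub h (m.factorization p)
  conv_rhs => rw [hc, pow_mul, pow_mul]
  exact h1.trans (sub_dvd_pow_sub_pow _ _ _)

/-- A solution of the triangular system `c I = ∑_{kJ = I} gcd(J) a_J ^ k`, where there is one. -/
noncomputable def solve (c : Idx n → A) (I : Idx n) : A :=
  Classical.epsilon fun x => c I = I.gcd * x +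
    ∑ f : {f : Factor I // f.k ≠ 1}, (f.1.J.gcd : A) * solve c f.1.J ^ f.1.k
termination_by I.gcd
decreasing_by exact Factor.gcd_lt f.2

/-- The congruences that characterise ghost vectors, relative to Frobenius lifts `ψ p`. -/
def IsDwork (ψ : ℕ → A →+* A) (c : Idx n → A) : Prop :=
  ∀ p : ℕ, p.Prime → ∀ I J : Idx n, p • J.1 = I.1 →
    (p : A) ^ I.gcd.factorization p ∣ c I - ψ p (c J)

/-- The map `(k, J) ↦ (p k, J)` -/
def Factor.mulLeft {I K : Idx n} (p : ℕ) (h : p • K.1 = I.1) (f : Factor K) : Factor I :=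
  ⟨(p * f.k, f.J), by
    change (p * f.k) • f.J.1 = I.1
    rw [mul_smul, f.smul_eq, h]⟩

theorem exists_mulLeft {I K : Idx n} {p : ℕ} (hp : p.Prime) (h : p • K.1 = I.1) (f : Factor I)
    (hf : p ∣ f.k) : ∃ g : Factor K, g.mulLeft p h = f := by
  obtain ⟨m, hm⟩ := hf
  refine ⟨⟨(m, f.J), ?_⟩, Factor.k_injective hm.symm⟩
  have h1 := f.smul_eq
  rw [hm, ← h, mul_smul] at h1
  funext i
  exact Nat.eq_of_mul_eq_mul_left hp.pos (congrFun h1 i)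

theorem factorization_gcd_of_not_dvd {I : Idx n} {p : ℕ} (f : Factor I)
    (hf : ¬ p ∣ f.k) : f.J.gcd.factorization p = I.gcd.factorization p := by
  rw [← f.k_mul_gcd, Nat.factorization_mul f.k_pos.ne' f.J.gcd_pos.ne']
  simp [Nat.factorization_eq_zero_of_not_dvd hf]

/-- If `ψ p` lifts Frobenius then ghost sums satisfy the congruences. -/
theorem dwork_step (ψ : A →+* A) {p : ℕ} (hp : p.Prime) (hψ : ∀ a, (p : A) ∣ ψ a - a ^ p)
    {I K : Idx n} (h : p • K.1 = I.1) (a : Idx n → A) (s : Finset (Factor I))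
    (hs : ∀ f : Factor I, p ∣ f.k → f ∈ s) :
    (p : A) ^ I.gcd.factorization p ∣
      ∑ f ∈ s, (f.J.gcd : A) * a f.J ^ f.k -
        ψ (∑ f : Factor K, (f.J.gcd : A) * a f.J ^ f.k) := by
  classical
  rw [← Finset.sum_filter_add_sum_filter_not s (fun f => p ∣ f.k)]
  have h1 : ∑ f ∈ s with p ∣ f.k, (f.J.gcd : A) * a f.J ^ f.k =
      ∑ f : Factor K, (f.J.gcd : A) * a f.J ^ (p * f.k) := by
    symm
    refine Finset.sum_bij (fun f _ => f.mulLeft p h) ?_ ?_ ?_ ?_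
    · intro f _
      have : p ∣ (f.mulLeft p h).k := dvd_mul_right _ _
      exact Finset.mem_filter.2 ⟨hs _ this, this⟩
    · intro f _ g _ hfg
      apply Factor.k_injective
      have : p * f.k = p * g.k := congrArg Factor.k hfg
      exact Nat.eq_of_mul_eq_mul_left hp.pos this
    · intro f hf
      obtain ⟨g, hg⟩ := exists_mulLeft hp h f (Finset.mem_filter.1 hf).2
      exact ⟨g, Finset.mem_univ _, hg⟩
    · intro f _
      rfl
  rw [h1, add_sub_right_comm]
  refine dvd_add ?_ (Finset.dvd_sum fun f hf => ?_)
  · rw [map_sum, ← Finset.sum_sub_distrib]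
    refine Finset.dvd_sum fun f _ => ?_
    rw [map_mul, map_natCast, map_pow, ← mul_sub, pow_mul]
    have h2 := pow_dvd_sub_pow (m := f.k) (hψ (a f.J))
    rw [← neg_sub, mul_neg, dvd_neg]
    have h3 : I.gcd.factorization p = f.J.gcd.factorization p + (f.k.factorization p + 1) := by
      rw [← (f.mulLeft p h).k_mul_gcd]
      change (p * f.k * f.J.gcd).factorization p = _
      rw [Nat.factorization_mul (mul_ne_zero hp.ne_zero f.k_pos.ne') f.J.gcd_pos.ne',
        Nat.factorization_mul hp.ne_zero f.k_pos.ne']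
      simp [hp.factorization_self]
      ring
    rw [h3, pow_add]
    refine mul_dvd_mul ?_ h2
    rw [← Nat.cast_pow]
    exact Nat.cast_dvd_cast (Nat.ordProj_dvd _ _)
  · have h2 := factorization_gcd_of_not_dvd f (Finset.mem_filter.1 hf).2
    rw [← h2, ← Nat.cast_pow]
    exact (Nat.cast_dvd_cast (Nat.ordProj_dvd _ _)).mul_right _

theorem solve_spec (ψ : ℕ → A →+* A) (hψ : ∀ p : ℕ, p.Prime → ∀ a, (p : A) ∣ ψ p a - a ^ p)
    (c : Idx n → A) (hc : IsDwork ψ c) (I : Idx n) :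
    c I = ∑ f : Factor I, (f.J.gcd : A) * solve c f.J ^ f.k := by
  classical
  induction hg : I.gcd using Nat.strong_induction_on generalizing I with
  | _ g ih =>
    subst hg
    have key : ∃ x, c I = I.gcd * x +
        ∑ f : {f : Factor I // f.k ≠ 1}, (f.1.J.gcd : A) * solve c f.1.J ^ f.1.k := by
      suffices hd : (I.gcd : A) ∣ c I -
          ∑ f : {f : Factor I // f.k ≠ 1}, (f.1.J.gcd : A) * solve c f.1.J ^ f.1.k by
        obtain ⟨x, hx⟩ := hd
        exact ⟨x, by rw [← hx]; ring⟩
      refine natCast_dvd_of_primes _ I.gcd_pos.ne' _ fun p hp hpI => ?_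
      obtain ⟨K, hK⟩ : ∃ K : Idx n, p • K.1 = I.1 := by
        have hdiv : ∀ i, p ∣ I.1 i := fun i => hpI.trans (Finset.gcd_dvd (Finset.mem_univ i))
        have : p • (fun i => I.1 i / p) = I.1 := by
          funext i
          exact Nat.mul_div_cancel' (hdiv i)
        refine ⟨⟨fun i => I.1 i / p, fun h0 => I.2 ?_⟩, this⟩
        rw [← this, h0, smul_zero]
      have hKI : K.gcd < I.gcd :=
        Factor.gcd_lt (f := (⟨(p, K), hK⟩ : Factor I)) hp.one_lt.ne'
      have h1 := hc p hp I K hK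
      have h2 := dwork_step (ψ p) hp (hψ p hp) hK (solve c)
        (Finset.univ.filter fun f : Factor I => f.k ≠ 1) (fun f hf => by
          simp only [Finset.mem_filter, Finset.mem_univ, true_and]
          intro h
          rw [h] at hf
          exact hp.one_lt.ne' (Nat.dvd_one.1 hf))
      rw [← ih K.gcd hKI K rfl] at h2
      have h3 := dvd_sub h1 h2
      rw [sub_sub_sub_cancel_right] at h3
      rwa [Finset.sum_subtype (p := fun f : Factor I => f.k ≠ 1) _ (by simp)] at h3
    have h1 := Classical.epsilon_spec key
    rw [sum_factor]
    change c I = (I.gcd : A) * solve c I ^ 1 + _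
    rw [pow_one]
    conv_rhs => rw [solve]
    exact h1

theorem ghost_injective_aux [IsAddTorsionFree A] (a b : Idx n → A)
    (h : ∀ I, ∑ f : Factor I, (f.J.gcd : A) * a f.J ^ f.k =
      ∑ f : Factor I, (f.J.gcd : A) * b f.J ^ f.k) (I : Idx n) : a I = b I := by
  induction hg : I.gcd using Nat.strong_induction_on generalizing I with
  | _ g ih =>
    subst hg
    have h1 := h I
    rw [sum_factor, sum_factor, Finset.sum_congr rfl (fun (f : {f : Factor I // f.k ≠ 1}) _ => by
      rw [ih _ (Factor.gcd_lt f.2) _ rfl])] at h1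
    have h2 := add_right_cancel h1
    change (I.gcd : A) * a I ^ 1 = (I.gcd : A) * b I ^ 1 at h2
    rw [pow_one, pow_one, ← nsmul_eq_mul, ← nsmul_eq_mul] at h2
    exact nsmul_right_injective I.gcd_pos.ne' h2

end Dwork

open MvPolynomial in
theorem dvd_expand_sub_pow {τ : Type*} (p : ℕ) (hp : p.Prime) (a : MvPolynomial τ ℤ) :
    (p : MvPolynomial τ ℤ) ∣ expand p a - a ^ p := by
  have := Fact.mk hp
  have h : (p : MvPolynomial τ ℤ) = C (p : ℤ) := by simp
  rw [h, C_dvd_iff_zmod, map_sub, map_pow, map_expand, expand_zmod, sub_self]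

theorem aeval_congr_dvd {κ A : Type*} [CommRing A] (Φ : MvPolynomial κ ℤ) (q : A) (a b : κ → A)
    (h : ∀ i, q ∣ a i - b i) : q ∣ MvPolynomial.aeval a Φ - MvPolynomial.aeval b Φ := by
  have hq : ∀ x y : A, q ∣ x - y ↔
      Ideal.Quotient.mkₐ ℤ (Ideal.span {q}) x = Ideal.Quotient.mkₐ ℤ (Ideal.span {q}) y := by
    intro x y
    rw [← Ideal.mem_span_singleton, ← Ideal.Quotient.eq]
    rfl
  rw [hq, MvPolynomial.comp_aeval_apply, MvPolynomial.comp_aeval_apply]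
  congr 2
  funext i
  exact (hq _ _).1 (h i)

section Struct

variable {κ : Type} (Φ : MvPolynomial κ ℤ)

/-- The polynomials over `ℤ` which give the coordinates of the operation on Witt vectors that
corresponds to the operation `Φ` on ghost components; see `structPoly_spec`. -/
noncomputable def structPoly : Idx n → MvPolynomial (κ × Idx n) ℤ :=
  solve fun I => MvPolynomial.aeval (fun i => ∑ f : Factor I,
    (f.J.gcd : MvPolynomial (κ × Idx n) ℤ) * MvPolynomial.X (i, f.J) ^ f.k) Φ

theorem structPoly_spec (I : Idx n) :
    MvPolynomial.aeval (fun i => ∑ f : Factor I,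
      (f.J.gcd : MvPolynomial (κ × Idx n) ℤ) * MvPolynomial.X (i, f.J) ^ f.k) Φ =
    ∑ f : Factor I, (f.J.gcd : MvPolynomial (κ × Idx n) ℤ) * structPoly Φ f.J ^ f.k := by
  refine solve_spec (fun p => (MvPolynomial.expand p :
    MvPolynomial (κ × Idx n) ℤ →ₐ[ℤ] _).toRingHom) dvd_expand_sub_pow
    (fun I => MvPolynomial.aeval (fun i => ∑ f : Factor I,
    (f.J.gcd : MvPolynomial (κ × Idx n) ℤ) * MvPolynomial.X (i, f.J) ^ f.k) Φ) ?_ I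
  intro p hp I K hK
  change _ ∣ _ - MvPolynomial.expand p (MvPolynomial.aeval _ Φ)
  rw [MvPolynomial.comp_aeval_apply]
  refine aeval_congr_dvd _ _ _ _ fun i => ?_
  exact dwork_step (MvPolynomial.expand p :
    MvPolynomial (κ × Idx n) ℤ →ₐ[ℤ] _).toRingHom hp (dvd_expand_sub_pow p hp) hK
    (fun J => MvPolynomial.X (i, J)) Finset.univ (fun _ _ => Finset.mem_univ _)

end Struct

/-- The set `𝕎(B)` of Witt vectors on `ℤ_{≥0}^n - 0` with components in `B`. -/
@[ext]
structure Witt (n : ℕ) (B : Type*) where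
  /-- The components `r_I` of a Witt vector. -/
  coeff : Idx n → B

namespace Witt

section Basic

variable {B B' : Type*} [CommRing B] [CommRing B']

/-- The ghost component `w_I = ∑_{k J = I} gcd(J) r_J ^ k`. -/
noncomputable def ghost (x : Witt n B) (I : Idx n) : B :=
  ∑ f : Factor I, (f.J.gcd : B) * x.coeff f.J ^ f.k

/-- The map on Witt vectors induced by a map of components. -/
def mapFun (φ : B → B') (x : Witt n B) : Witt n B' := ⟨fun I => φ (x.coeff I)⟩

/-- The operation on Witt vectors that corresponds to `Φ` on ghost components. -/
noncomputable def op {κ : Type} (Φ : MvPolynomial κ ℤ) (x : κ → Witt n B) : Witt n B :=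
  ⟨fun I => MvPolynomial.aeval (fun v : κ × Idx n => (x v.1).coeff v.2) (structPoly Φ I)⟩

theorem ghost_op {κ : Type} (Φ : MvPolynomial κ ℤ) (x : κ → Witt n B) (I : Idx n) :
    (op Φ x).ghost I = MvPolynomial.aeval (fun i => (x i).ghost I) Φ := by
  have h := congrArg (MvPolynomial.aeval (fun v : κ × Idx n => (x v.1).coeff v.2))
    (structPoly_spec (n := n) Φ I)
  rw [MvPolynomial.comp_aeval_apply] at h
  simp only [map_sum, map_mul, map_natCast, map_pow, MvPolynomial.aeval_X] at h
  exact h.symm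

theorem ghost_mapFun (φ : B →+* B') (x : Witt n B) (I : Idx n) :
    (mapFun φ x).ghost I = φ (x.ghost I) := by
  simp [ghost, mapFun]

theorem mapFun_op {κ : Type} (Φ : MvPolynomial κ ℤ) (φ : B →+* B') (x : κ → Witt n B) :
    mapFun φ (op Φ x) = op Φ (fun i => mapFun φ (x i)) := by
  ext I
  change φ.toIntAlgHom (MvPolynomial.aeval _ _) = _
  rw [MvPolynomial.comp_aeval_apply]
  rfl

theorem ghost_injective [IsAddTorsionFree B] {x y : Witt n B} (h : ∀ I, x.ghost I = y.ghost I) :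
    x = y := by
  ext I
  exact ghost_injective_aux _ _ h I

noncomputable instance : Zero (Witt n B) := ⟨⟨fun _ => 0⟩⟩
noncomputable instance : One (Witt n B) := ⟨op 1 Empty.elim⟩
noncomputable instance : Add (Witt n B) :=
  ⟨fun x y => op (MvPolynomial.X 0 + MvPolynomial.X 1) ![x, y]⟩
noncomputable instance : Mul (Witt n B) :=
  ⟨fun x y => op (MvPolynomial.X 0 * MvPolynomial.X 1) ![x, y]⟩
noncomputable instance : Neg (Witt n B) :=
  ⟨fun x => op (-MvPolynomial.X ()) fun _ => x⟩

theorem zero_coeff (I : Idx n) : (0 : Witt n B).coeff I = 0 := rfl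
theorem add_def (x y : Witt n B) :
    x + y = op (MvPolynomial.X 0 + MvPolynomial.X 1) ![x, y] := rfl
theorem mul_def (x y : Witt n B) :
    x * y = op (MvPolynomial.X 0 * MvPolynomial.X 1) ![x, y] := rfl
theorem neg_def (x : Witt n B) : -x = op (-MvPolynomial.X ()) fun _ => x := rfl
theorem one_def : (1 : Witt n B) = op 1 Empty.elim := rfl

theorem ghost_zero (I : Idx n) : (0 : Witt n B).ghost I = 0 := by
  refine Finset.sum_eq_zero fun f _ => ?_
  rw [zero_coeff, zero_pow f.k_pos.ne', mul_zero]

theorem ghost_one (I : Idx n) : (1 : Witt n B).ghost I = 1 := by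
  rw [one_def, ghost_op, map_one]

theorem ghost_add (x y : Witt n B) (I : Idx n) :
    (x + y).ghost I = x.ghost I + y.ghost I := by
  rw [add_def, ghost_op]; simp

theorem ghost_mul (x y : Witt n B) (I : Idx n) :
    (x * y).ghost I = x.ghost I * y.ghost I := by
  rw [mul_def, ghost_op]; simp

theorem ghost_neg (x : Witt n B) (I : Idx n) : (-x).ghost I = -x.ghost I := by
  rw [neg_def, ghost_op]; simp

theorem mapFun_zero (φ : B →+* B') : mapFun φ (0 : Witt n B) = 0 := by
  ext I; exact map_zero φ

theorem mapFun_one (φ : B →+* B') : mapFun φ (1 : Witt n B) = 1 := by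
  rw [one_def, mapFun_op, one_def]
  congr 1
  funext i
  exact i.elim

theorem mapFun_add (φ : B →+* B') (x y : Witt n B) :
    mapFun φ (x + y) = mapFun φ x + mapFun φ y := by
  rw [add_def, mapFun_op, add_def]
  congr 1
  funext i
  fin_cases i <;> rfl

theorem mapFun_mul (φ : B →+* B') (x y : Witt n B) :
    mapFun φ (x * y) = mapFun φ x * mapFun φ y := by
  rw [mul_def, mapFun_op, mul_def]
  congr 1
  funext i
  fin_cases i <;> rfl

theorem mapFun_neg (φ : B →+* B') (x : Witt n B) : mapFun φ (-x) = -mapFun φ x := by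
  rw [neg_def, mapFun_op, neg_def]

/-- Every Witt vector lifts to one over a ring without torsion, compatibly for all of `𝕎(B)`. -/
theorem exists_lift (x : Witt n B) : ∃ y : Witt n (MvPolynomial B ℤ),
    mapFun (MvPolynomial.aeval (R := ℤ) (id : B → B)).toRingHom y = x :=
  ⟨⟨fun I => MvPolynomial.X (x.coeff I)⟩, by
    ext I
    change MvPolynomial.aeval (R := ℤ) (id : B → B) (MvPolynomial.X (x.coeff I)) = _
    rw [MvPolynomial.aeval_X]; rfl⟩

theorem add_assoc' (x y z : Witt n B) : x + y + z = x + (y + z) := by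
  obtain ⟨x, rfl⟩ := exists_lift x
  obtain ⟨y, rfl⟩ := exists_lift y
  obtain ⟨z, rfl⟩ := exists_lift z
  simp only [← mapFun_add]
  congr 1
  exact ghost_injective fun I => by simp only [ghost_add]; ring

theorem zero_add' (x : Witt n B) : 0 + x = x := by
  obtain ⟨x, rfl⟩ := exists_lift x
  rw [← mapFun_zero (MvPolynomial.aeval (R := ℤ) (id : B → B)).toRingHom, ← mapFun_add]
  congr 1
  exact ghost_injective fun I => by simp only [ghost_add, ghost_zero]; ring

theorem add_comm' (x y : Witt n B) : x + y = y + x := by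
  obtain ⟨x, rfl⟩ := exists_lift x
  obtain ⟨y, rfl⟩ := exists_lift y
  simp only [← mapFun_add]
  congr 1
  exact ghost_injective fun I => by simp only [ghost_add]; ring

theorem neg_add_cancel' (x : Witt n B) : -x + x = 0 := by
  obtain ⟨x, rfl⟩ := exists_lift x
  rw [← mapFun_zero (MvPolynomial.aeval (R := ℤ) (id : B → B)).toRingHom, ← mapFun_neg,
    ← mapFun_add]
  congr 1
  exact ghost_injective fun I => by simp only [ghost_add, ghost_zero, ghost_neg]; ring

theorem mul_assoc' (x y z : Witt n B) : x * y * z = x * (y * z) := by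
  obtain ⟨x, rfl⟩ := exists_lift x
  obtain ⟨y, rfl⟩ := exists_lift y
  obtain ⟨z, rfl⟩ := exists_lift z
  simp only [← mapFun_mul]
  congr 1
  exact ghost_injective fun I => by simp only [ghost_mul]; ring

theorem mul_comm' (x y : Witt n B) : x * y = y * x := by
  obtain ⟨x, rfl⟩ := exists_lift x
  obtain ⟨y, rfl⟩ := exists_lift y
  simp only [← mapFun_mul]
  congr 1
  exact ghost_injective fun I => by simp only [ghost_mul]; ring

theorem one_mul' (x : Witt n B) : 1 * x = x := by
  obtain ⟨x, rfl⟩ := exists_lift x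
  rw [← mapFun_one (MvPolynomial.aeval (R := ℤ) (id : B → B)).toRingHom, ← mapFun_mul]
  congr 1
  exact ghost_injective fun I => by simp only [ghost_mul, ghost_one]; ring

theorem zero_mul' (x : Witt n B) : 0 * x = 0 := by
  obtain ⟨x, rfl⟩ := exists_lift x
  rw [← mapFun_zero (MvPolynomial.aeval (R := ℤ) (id : B → B)).toRingHom, ← mapFun_mul]
  congr 1
  exact ghost_injective fun I => by simp only [ghost_mul, ghost_zero]; ring

theorem left_distrib' (x y z : Witt n B) : x * (y + z) = x * y + x * z := by
  obtain ⟨x, rfl⟩ := exists_lift x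
  obtain ⟨y, rfl⟩ := exists_lift y
  obtain ⟨z, rfl⟩ := exists_lift z
  simp only [← mapFun_mul, ← mapFun_add]
  congr 1
  exact ghost_injective fun I => by simp only [ghost_mul, ghost_add]; ring

/-- The ring structure of `𝕎(B)`; it is functorial in `B` (`Witt.map`) and the ghost map is a ring
homomorphism (`Witt.ghostHom`). -/
noncomputable instance : CommRing (Witt n B) where
  add_assoc := add_assoc'
  zero_add := zero_add'
  add_zero x := (add_comm' _ _).trans (zero_add' x)
  add_comm := add_comm'
  neg_add_cancel := neg_add_cancel'
  mul_assoc := mul_assoc'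
  mul_comm := mul_comm'
  one_mul := one_mul'
  mul_one x := (mul_comm' _ _).trans (one_mul' x)
  zero_mul := zero_mul'
  mul_zero x := (mul_comm' _ _).trans (zero_mul' x)
  left_distrib := left_distrib'
  right_distrib x y z := by
    rw [mul_comm', left_distrib', mul_comm' z, mul_comm' z]
  nsmul := nsmulRec
  zsmul := zsmulRec

/-- The ghost map, a ring homomorphism. -/
noncomputable def ghostHom : Witt n B →+* (Idx n → B) where
  toFun := ghost
  map_zero' := funext ghost_zero
  map_one' := funext ghost_one
  map_add' x y := funext (ghost_add x y)
  map_mul' x y := funext (ghost_mul x y)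

/-- Functoriality of `𝕎`. -/
noncomputable def map (φ : B →+* B') : Witt n B →+* Witt n B' where
  toFun := mapFun φ
  map_zero' := mapFun_zero φ
  map_one' := mapFun_one φ
  map_add' := mapFun_add φ
  map_mul' := mapFun_mul φ

end Basic

end Witt

section Homogeneous

variable {κ : Type} (Φ : MvPolynomial κ ℤ)

/-- The structure polynomials of operations which are linear on ghost components are homogeneous,
where the variables with index `J` have weight `deg J`. -/
theorem structPoly_homogeneous
    (hΦ : ∀ (m : ℕ) (g : κ → MvPolynomial (κ × Idx n) ℤ),
      (∀ i, (g i).IsWeightedHomogeneous (fun v : κ × Idx n => v.2.deg) m) →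
      (MvPolynomial.aeval g Φ).IsWeightedHomogeneous (fun v : κ × Idx n => v.2.deg) m)
    (I : Idx n) :
    (structPoly Φ I).IsWeightedHomogeneous (fun v : κ × Idx n => v.2.deg) I.deg := by
  induction hg : I.gcd using Nat.strong_induction_on generalizing I with
  | _ g ih =>
    subst hg
    have hC : ∀ a : ℕ, (a : MvPolynomial (κ × Idx n) ℤ) = MvPolynomial.C (a : ℤ) := by
      intro a; simp
    have h1 := hΦ I.deg (fun i => ∑ f : Factor I,
      (f.J.gcd : MvPolynomial (κ × Idx n) ℤ) * MvPolynomial.X (i, f.J) ^ f.k) (fun i => by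
        refine MvPolynomial.IsWeightedHomogeneous.sum _ _ _ fun f _ => ?_
        rw [hC, ← f.k_mul_deg, ← smul_eq_mul]
        exact ((MvPolynomial.isWeightedHomogeneous_X ℤ
          (fun v : κ × Idx n => v.2.deg) (i, f.J)).pow f.k).C_mul _)
    rw [structPoly_spec, sum_factor] at h1
    have h2 : (∑ f : {f : Factor I // f.k ≠ 1}, (f.1.J.gcd : MvPolynomial (κ × Idx n) ℤ) *
        structPoly Φ f.1.J ^ f.1.k).IsWeightedHomogeneous
          (fun v : κ × Idx n => v.2.deg) I.deg := by
      refine MvPolynomial.IsWeightedHomogeneous.sum _ _ _ fun f _ => ?_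
      rw [hC, ← f.1.k_mul_deg, ← smul_eq_mul]
      exact ((ih _ (Factor.gcd_lt f.2) _ rfl).pow f.1.k).C_mul _
    have h3 := h1.sub h2
    rw [add_sub_cancel_right] at h3
    change ((I.gcd : MvPolynomial (κ × Idx n) ℤ) *
      structPoly Φ I ^ 1).IsWeightedHomogeneous _ _ at h3
    rw [pow_one, hC] at h3
    intro d hd
    apply h3
    rw [MvPolynomial.coeff_C_mul]
    exact mul_ne_zero (by exact_mod_cast I.gcd_pos.ne') hd

theorem add_homogeneous (I : Idx n) :
    (structPoly (MvPolynomial.X 0 + MvPolynomial.X 1 : MvPolynomial (Fin 2) ℤ)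
      I).IsWeightedHomogeneous (fun v : Fin 2 × Idx n => v.2.deg) I.deg := by
  refine structPoly_homogeneous _ (fun m g hg => ?_) I
  rw [map_add, MvPolynomial.aeval_X, MvPolynomial.aeval_X]
  exact (hg 0).add (hg 1)

theorem neg_homogeneous (I : Idx n) :
    (structPoly (-MvPolynomial.X () : MvPolynomial Unit ℤ)
      I).IsWeightedHomogeneous (fun v : Unit × Idx n => v.2.deg) I.deg := by
  refine structPoly_homogeneous _ (fun m g hg => ?_) I
  rw [map_neg, MvPolynomial.aeval_X]
  exact (hg ()).neg

/-- A homogeneous polynomial of large weight vanishes on a family of elements of a nilpotent ideal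
which is zero for large weights. -/
theorem aeval_eq_zero_of_homogeneous {τ B : Type*} [CommRing B] (w : τ → ℕ)
    {P : MvPolynomial τ ℤ} {m : ℕ} (hP : P.IsWeightedHomogeneous w m) (b : τ → B) (𝔫 : Ideal B)
    (hb : ∀ v, b v ∈ 𝔫) (K M : ℕ) (h𝔫 : 𝔫 ^ K = ⊥) (hM : ∀ v, M < w v → b v = 0)
    (hm : M * K ≤ m) (hm0 : 0 < m) : MvPolynomial.aeval b P = 0 := by
  rw [MvPolynomial.aeval_def, MvPolynomial.eval₂_eq]
  refine Finset.sum_eq_zero fun d hd => ?_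
  have hw := hP (MvPolynomial.mem_support_iff.1 hd)
  by_cases h : ∃ v ∈ d.support, M < w v
  · obtain ⟨v, hv, hMv⟩ := h
    rw [Finset.prod_eq_zero hv, mul_zero]
    rw [hM v hMv, zero_pow (Finsupp.mem_support_iff.1 hv)]
  · push Not at h
    have h1 : m ≤ M * ∑ v ∈ d.support, d v := by
      rw [← hw, Finsupp.weight_apply, Finsupp.sum, Finset.mul_sum]
      refine Finset.sum_le_sum fun v hv => ?_
      rw [smul_eq_mul, mul_comm]
      exact Nat.mul_le_mul_right _ (h v hv)
    have h2 : K ≤ ∑ v ∈ d.support, d v := by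
      refine Nat.le_of_mul_le_mul_left (hm.trans h1) ?_
      rcases Nat.eq_zero_or_pos M with h0 | h0
      · rw [h0, zero_mul] at h1; omega
      · exact h0
    have h3 : ∏ v ∈ d.support, b v ^ d v ∈ 𝔫 ^ ∑ v ∈ d.support, d v := by
      rw [← Finset.prod_pow_eq_pow_sum]
      exact Ideal.prod_mem_prod fun v _ => Ideal.pow_mem_pow (hb v) _
    have h4 := Ideal.pow_le_pow_right h2 h3
    rw [h𝔫, Ideal.mem_bot] at h4
    rw [h4, mul_zero]

theorem aeval_mem_of_homogeneous {τ B : Type*} [CommRing B] (w : τ → ℕ)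
    {P : MvPolynomial τ ℤ} {m : ℕ} (hP : P.IsWeightedHomogeneous w m) (b : τ → B) (𝔫 : Ideal B)
    (hb : ∀ v, b v ∈ 𝔫) (hm0 : 0 < m) : MvPolynomial.aeval b P ∈ 𝔫 := by
  rw [MvPolynomial.aeval_def, MvPolynomial.eval₂_eq]
  refine 𝔫.sum_mem fun d hd => 𝔫.mul_mem_left _ ?_
  have hw := hP (MvPolynomial.mem_support_iff.1 hd)
  have : d.support.Nonempty := by
    rw [Finsupp.support_nonempty_iff]
    rintro rfl
    rw [map_zero] at hw
    omega
  obtain ⟨v, hv⟩ := this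
  exact Ideal.mem_of_dvd _ (Finset.dvd_prod_of_mem _ hv)
    (𝔫.pow_mem_of_mem (hb v) _ (Nat.pos_of_ne_zero (Finsupp.mem_support_iff.1 hv)))

end Homogeneous

namespace Witt

variable {B B' : Type*} [CommRing B] [CommRing B']

/-- All components are nilpotent and almost all of them are zero. -/
def IsSmall (x : Witt n B) : Prop :=
  (∀ I, IsNilpotent (x.coeff I)) ∧ {I | x.coeff I ≠ 0}.Finite

theorem IsSmall.exists_bounds {κ : Type} [Finite κ] {x : κ → Witt n B} (hx : ∀ i, (x i).IsSmall) :
    ∃ (𝔫 : Ideal B) (K M : ℕ), 𝔫 ^ K = ⊥ ∧ (∀ i I, (x i).coeff I ∈ 𝔫) ∧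
      ∀ i I, M < I.deg → (x i).coeff I = 0 := by
  have hfin : {v : κ × Idx n | (x v.1).coeff v.2 ≠ 0}.Finite := by
    have := Set.finite_iUnion fun i => (hx i).2.image fun I => (i, I)
    refine this.subset ?_
    rintro ⟨i, I⟩ h
    exact Set.mem_iUnion.2 ⟨i, I, h, rfl⟩
  have hs : ((fun v : κ × Idx n => (x v.1).coeff v.2) '' {v | (x v.1).coeff v.2 ≠ 0}).Finite :=
    hfin.image _
  have hnil : IsNilpotent (Ideal.span
      ((fun v : κ × Idx n => (x v.1).coeff v.2) '' {v | (x v.1).coeff v.2 ≠ 0})) := by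
    refine (Ideal.FG.isNilpotent_iff_le_nilradical ⟨hs.toFinset, by simp⟩).2 ?_
    rw [Ideal.span_le]
    rintro _ ⟨v, _, rfl⟩
    exact (hx v.1).1 v.2
  obtain ⟨K, hK⟩ := hnil
  obtain ⟨M, hM⟩ := (hfin.image fun v => v.2.deg).bddAbove
  refine ⟨_, K, M, hK, fun i I => ?_, fun i I hI => ?_⟩
  · by_cases h : (x i).coeff I = 0
    · rw [h]; exact Ideal.zero_mem _
    · exact Ideal.subset_span ⟨(i, I), h, rfl⟩
  · by_contra h
    exact absurd (hM ⟨(i, I), h, rfl⟩) (not_le.2 hI)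

theorem IsSmall.op {κ : Type} [Finite κ] {Φ : MvPolynomial κ ℤ}
    (hΦ : ∀ I : Idx n, (structPoly Φ I).IsWeightedHomogeneous
      (fun v : κ × Idx n => v.2.deg) I.deg) {x : κ → Witt n B} (hx : ∀ i, (x i).IsSmall) :
    (op Φ x).IsSmall := by
  obtain ⟨𝔫, K, M, hK, hmem, hM⟩ := IsSmall.exists_bounds hx
  constructor
  · intro I
    have := aeval_mem_of_homogeneous _ (hΦ I) (fun v => (x v.1).coeff v.2) 𝔫
      (fun v => hmem _ _) I.deg_pos
    have h := Ideal.pow_mem_pow this K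
    rw [hK, Ideal.mem_bot] at h
    exact ⟨K, h⟩
  · refine (Idx.finite_deg_le n (M * K)).subset fun I hI => ?_
    by_contra h
    exact hI (aeval_eq_zero_of_homogeneous _ (hΦ I) (fun v => (x v.1).coeff v.2) 𝔫
      (fun v => hmem _ _) K M hK (fun v => hM _ _) (not_le.1 h).le I.deg_pos)

variable (n B) in
/-- The `B`-points of the additive formal group of `𝕎`: the additive group of the Witt vectors
with nilpotent components, almost all of them zero. -/
noncomputable def small : AddSubgroup (Witt n B) where
  carrier := {x | x.IsSmall}
  zero_mem' := ⟨fun _ => IsNilpotent.zero, by simp [zero_coeff]⟩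
  add_mem' {x y} hx hy := IsSmall.op add_homogeneous (x := ![x, y]) fun i => by
    fin_cases i
    exacts [hx, hy]
  neg_mem' {x} hx := IsSmall.op neg_homogeneous (x := fun _ => x) fun _ => hx

/-- Functoriality of `Witt.small`. -/
noncomputable def smallMap (φ : B →+* B') : small n B →+ small n B' :=
  ((map φ).toAddMonoidHom.comp (small n B).subtype).codRestrict (small n B') fun x =>
    ⟨fun I => (x.2.1 I).map φ, x.2.2.subset fun I h h0 => h (by
      change φ (x.1.coeff I) = 0
      rw [h0, map_zero])⟩

end Witt

end MultiWitt

namespace FormalGeometry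

section Formal

variable (R : Type u) [CommRing R]

/-- A formal scheme over `R`, given by its functor of points on `R`-algebras: a functor which is a
small filtered colimit of affine schemes over `R` (that is, of representable functors). -/
def IsFormalScheme (X : CommAlgCat.{u} R ⥤ Type u) : Prop :=
  IsIndObject (unopUnop (CommAlgCat.{u} R) ⋙ X)

/-- A formal scheme over `R` with a distinguished `R`-point `Spec R → X`. -/
structure PointedFormalScheme where
  /-- The functor of points. -/
  X : CommAlgCat.{u} R ⥤ Type u
  isFormalScheme : IsFormalScheme R X
  /-- The distinguished point. -/
  pt : X.obj (CommAlgCat.of R R)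

variable {R}

/-- A morphism of pointed formal schemes: a morphism over `R` that preserves the points. -/
@[ext]
structure PointedFormalScheme.Hom (X Y : PointedFormalScheme R) where
  /-- The underlying morphism. -/
  hom : X.X ⟶ Y.X
  map_pt : hom.app _ X.pt = Y.pt

instance : Category (PointedFormalScheme R) where
  Hom := PointedFormalScheme.Hom
  id X := ⟨𝟙 _, rfl⟩
  comp f g := ⟨f.hom ≫ g.hom, by
    rw [NatTrans.comp_app, types_comp_apply, f.map_pt, g.map_pt]⟩

variable (R) in
/-- The property of a functor from `R`-algebras to abelian groups of being a commutative formal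
group: the underlying functor to sets is a formal scheme. -/
def isCommFormalGroup : ObjectProperty (CommAlgCat.{u} R ⥤ AddCommGrpCat.{u}) :=
  fun G => IsFormalScheme R (G ⋙ forget AddCommGrpCat)

variable (R) in
/-- The category of commutative formal groups over `R`, i.e. of commutative group objects in formal
schemes over `R`. The morphisms are the natural transformations of group valued functors. -/
abbrev CommFormalGroup : Type (u + 1) := (isCommFormalGroup R).FullSubcategory

/-- A formal group is a pointed formal scheme, with the identity as its distinguished point. -/
def CommFormalGroup.pointed (G : CommFormalGroup R) : PointedFormalScheme R where
  X := G.obj ⋙ forget AddCommGrpCat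
  isFormalScheme := G.property
  pt := (0 : G.obj.obj (CommAlgCat.of R R))

section HomGroup

variable {X : PointedFormalScheme R} {G : CommFormalGroup R}

/-- Pointed morphisms into a formal group from functions that are natural and pointed. -/
def mkHom (f : ∀ A : CommAlgCat.{u} R, X.X.obj A → G.obj.obj A)
    (hf : ∀ (A B : CommAlgCat.{u} R) (φ : A ⟶ B) (x : X.X.obj A),
      f B (X.X.map φ x) = (G.obj.map φ).hom (f A x))
    (h0 : f _ X.pt = 0) : X ⟶ G.pointed where
  hom :=
    { app := fun A => TypeCat.ofHom (f A)
      naturality := fun A B φ => by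
        ext x
        exact hf A B φ x }
  map_pt := h0

/-- The value of a pointed morphism into a formal group at a point. -/
def homApp (f : X ⟶ G.pointed) (A : CommAlgCat.{u} R) (x : X.X.obj A) : G.obj.obj A :=
  f.hom.app A x

theorem homApp_pt (f : X ⟶ G.pointed) : homApp f _ X.pt = 0 := f.map_pt

theorem homApp_map (f : X ⟶ G.pointed) {A B : CommAlgCat.{u} R} (φ : A ⟶ B) (x : X.X.obj A) :
    homApp f B (X.X.map φ x) = (G.obj.map φ).hom (homApp f A x) :=
  NatTrans.naturality_apply f.hom φ x

theorem hom_ext' {f g : X ⟶ G.pointed} (h : ∀ A x, homApp f A x = homApp g A x) : f = g := by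
  refine PointedFormalScheme.Hom.ext ?_
  ext A x
  exact h A x

instance : Zero (X ⟶ G.pointed) :=
  ⟨mkHom (fun _ _ => 0) (fun _ _ φ _ => (map_zero (G.obj.map φ).hom).symm) rfl⟩

instance : Add (X ⟶ G.pointed) :=
  ⟨fun f g => mkHom (fun A x => homApp f A x + homApp g A x)
    (fun A B φ x => by rw [homApp_map, homApp_map, map_add])
    (by rw [homApp_pt, homApp_pt, add_zero])⟩

instance : Neg (X ⟶ G.pointed) :=
  ⟨fun f => mkHom (fun A x => -homApp f A x)
    (fun A B φ x => by rw [homApp_map, map_neg])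
    (by rw [homApp_pt, neg_zero])⟩

theorem homApp_add (f g : X ⟶ G.pointed) (A : CommAlgCat.{u} R) (x : X.X.obj A) :
    homApp (f + g) A x = homApp f A x + homApp g A x := rfl

theorem homApp_zero (A : CommAlgCat.{u} R) (x : X.X.obj A) :
    homApp (0 : X ⟶ G.pointed) A x = 0 := rfl

theorem homApp_neg (f : X ⟶ G.pointed) (A : CommAlgCat.{u} R) (x : X.X.obj A) :
    homApp (-f) A x = -homApp f A x := rfl

/-- The pointed morphisms from `X` to a commutative formal group form an abelian group under
pointwise addition. -/
instance : AddCommGroup (X ⟶ G.pointed) where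
  add_assoc f g h := hom_ext' fun A x => by simp only [homApp_add, add_assoc]
  zero_add f := hom_ext' fun A x => by simp only [homApp_add, homApp_zero, zero_add]
  add_zero f := hom_ext' fun A x => by simp only [homApp_add, homApp_zero, add_zero]
  add_comm f g := hom_ext' fun A x => by simp only [homApp_add, add_comm]
  neg_add_cancel f := hom_ext' fun A x => by
    simp only [homApp_add, homApp_neg, homApp_zero, neg_add_cancel]
  nsmul := nsmulRec
  zsmul := zsmulRec

end HomGroup

/-- A morphism of formal groups is a morphism of the underlying pointed formal schemes. -/
def CommFormalGroup.pointedMap {G H : CommFormalGroup R} (φ : G ⟶ H) : G.pointed ⟶ H.pointed where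
  hom := Functor.whiskerRight φ.hom (forget AddCommGrpCat)
  map_pt := map_zero (φ.hom.app (CommAlgCat.of R R)).hom

/-- The functor `G ↦ Mor_fs(X, G)` from commutative formal groups over `R` to abelian groups. -/
def morFs (X : PointedFormalScheme R) : CommFormalGroup R ⥤ AddCommGrpCat.{u + 1} where
  obj G := AddCommGrpCat.of (X ⟶ G.pointed)
  map {G H} φ := AddCommGrpCat.ofHom
    { toFun := fun f => f ≫ CommFormalGroup.pointedMap φ
      map_zero' := hom_ext' fun A _ => map_zero (φ.hom.app A).hom
      map_add' := fun f g => hom_ext' fun A x =>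
        map_add (φ.hom.app A).hom (homApp f A x) (homApp g A x) }
  map_id G := by
    ext f
    rfl
  map_comp φ ψ := by
    ext f
    rfl

end Formal

section Spf

variable (R : Type u) [CommRing R] (A : Type u) [CommRing A] [Algebra R A]

/-- The functor of points of the formal spectrum of a topological `R`-algebra `A`: the `B`-points
are the continuous `R`-algebra homomorphisms from `A` to `B`, where `B` is discrete. -/
def Spf (τ : TopologicalSpace A) : CommAlgCat.{u} R ⥤ Type u where
  obj B := {f : A →ₐ[R] B // @Continuous A B τ ⊥ f}
  map {B B'} φ := TypeCat.ofHom fun f => ⟨φ.hom.comp f.1,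
    @Continuous.comp A B B' τ ⊥ ⊥ f.1 φ.hom (continuous_bot) f.2⟩

variable {A} in
theorem continuous_iff_ker (τ : TopologicalSpace A) [IsTopologicalRing A] {B : Type u} [CommRing B]
    [Algebra R B] (f : A →ₐ[R] B) :
    @Continuous A B τ ⊥ f ↔ IsOpen (RingHom.ker f : Set A) := by
  let _ : TopologicalSpace B := ⊥
  have : DiscreteTopology B := ⟨rfl⟩
  constructor
  · intro h
    exact (isOpen_discrete ({0} : Set B)).preimage h
  · intro h
    refine continuous_of_continuousAt_zero f.toRingHom.toAddMonoidHom ?_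
    rw [ContinuousAt, nhds_discrete B, Filter.tendsto_pure]
    filter_upwards [h.mem_nhds (by simp)] with x hx
    change f x = f 0
    rw [map_zero]
    exact hx

/-- The open ideals of `A`, where smaller ideals come later. -/
def OpenIdeal [TopologicalSpace A] : Type u := {J : Ideal A // IsOpen (J : Set A)}ᵒᵈ

instance [TopologicalSpace A] : PartialOrder (OpenIdeal A) :=
  inferInstanceAs (PartialOrder {J : Ideal A // IsOpen (J : Set A)}ᵒᵈ)

variable {A} in
/-- The underlying ideal. -/
def OpenIdeal.ideal [TopologicalSpace A] (J : OpenIdeal A) : Ideal A := (OrderDual.ofDual J).1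

variable {A} in
theorem OpenIdeal.isOpen [TopologicalSpace A] (J : OpenIdeal A) : IsOpen (J.ideal : Set A) :=
  (OrderDual.ofDual J).2

instance [TopologicalSpace A] : Nonempty (OpenIdeal A) :=
  ⟨OrderDual.toDual ⟨⊤, isOpen_univ⟩⟩

instance [TopologicalSpace A] : IsDirectedOrder (OpenIdeal A) :=
  ⟨fun J K => ⟨OrderDual.toDual ⟨J.ideal ⊓ K.ideal, J.isOpen.inter K.isOpen⟩,
    (inf_le_left : J.ideal ⊓ K.ideal ≤ J.ideal), (inf_le_right : J.ideal ⊓ K.ideal ≤ K.ideal)⟩⟩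

/-- The ind-affine scheme formed by the `Spec (A / J)` for the open ideals `J`. -/
def openQuotients [TopologicalSpace A] : OpenIdeal A ⥤ (CommAlgCat.{u} R)ᵒᵖ where
  obj J := Opposite.op (CommAlgCat.of R (A ⧸ J.ideal))
  map {J K} h := (CommAlgCat.ofHom (Ideal.Quotient.factorₐ R
    (show K.ideal ≤ J.ideal from leOfHom h))).op
  map_id J := by
    congr 1
    ext x
    obtain ⟨x, rfl⟩ := Ideal.Quotient.mk_surjective x
    rfl
  map_comp f g := by
    congr 1
    ext x
    obtain ⟨x, rfl⟩ := Ideal.Quotient.mk_surjective x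
    rfl

/-- The cocone that exhibits `Spf A` as the filtered colimit of the `Spec (A / J)`. -/
def openQuotientsCocone [τ : TopologicalSpace A] [IsTopologicalRing A] :
    Cocone (openQuotients R A ⋙ yoneda) where
  pt := unopUnop (CommAlgCat.{u} R) ⋙ Spf R A τ
  ι :=
    { app := fun J =>
        { app := fun B => TypeCat.ofHom fun f =>
            ⟨(f.unop.hom : A ⧸ J.ideal →ₐ[R] B.unop.unop).comp (Ideal.Quotient.mkₐ R J.ideal), by
              rw [continuous_iff_ker]
              refine AddSubgroup.isOpen_mono (H₁ := J.ideal.toAddSubgroup)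
                (H₂ := (RingHom.ker ((f.unop.hom : A ⧸ J.ideal →ₐ[R] B.unop.unop).comp
                  (Ideal.Quotient.mkₐ R J.ideal))).toAddSubgroup) ?_ J.isOpen
              intro x hx
              change f.unop.hom (Ideal.Quotient.mk J.ideal x) = 0
              exact (congrArg f.unop.hom (Ideal.Quotient.eq_zero_iff_mem.2 hx)).trans
                (map_zero (f.unop.hom : A ⧸ J.ideal →ₐ[R] B.unop.unop))⟩
          naturality := fun B C φ => by
            ext f
            rfl }
      naturality := fun J K h => by
        ext B f
        rfl }

/-- The formal spectrum of a topological `R`-algebra is a formal scheme. -/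
theorem isFormalScheme_Spf (τ : TopologicalSpace A) [IsTopologicalRing A] :
    IsFormalScheme R (Spf R A τ) := by
  refine IsIndObject.mk (IndObjectPresentation.ofCocone (openQuotientsCocone R A) ?_)
  refine evaluationJointlyReflectsColimits _ fun B => ?_
  refine Types.FilteredColimit.isColimitOf' _ _ ?_ ?_
  · rintro ⟨f, hf⟩
    rw [continuous_iff_ker] at hf
    refine ⟨OrderDual.toDual ⟨RingHom.ker f, hf⟩,
      (CommAlgCat.ofHom (Ideal.kerLiftAlg f)).op, ?_⟩
    apply Subtype.ext
    ext x
    rfl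
  · intro J f g h
    refine ⟨J, 𝟙 J, ?_⟩
    congr 1
    apply Quiver.Hom.unop_inj
    ext x
    obtain ⟨x, rfl⟩ := Ideal.Quotient.mk_surjective x
    exact congrArg (fun t => t.1 x) h

end Spf

section PowerSeries

variable (σ : Type) (R : Type u) [CommRing R]

/-- The topology of coefficientwise convergence on `R⟦x_s : s ∈ σ⟧`, where `R` is discrete. For
finite `σ` this is the adic topology of the ideal generated by the variables. -/
abbrev powerSeriesTopology : TopologicalSpace (MvPowerSeries σ R) :=
  @MvPowerSeries.WithPiTopology.instTopologicalSpace σ R ⊥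

theorem isTopologicalRing_powerSeries :
    @IsTopologicalRing _ (powerSeriesTopology σ R) _ := by
  let _ : TopologicalSpace R := ⊥
  have : DiscreteTopology R := ⟨rfl⟩
  exact MvPowerSeries.WithPiTopology.instIsTopologicalRing σ R

theorem isFormalScheme_Spf_powerSeries :
    IsFormalScheme R (Spf R (MvPowerSeries σ R) (powerSeriesTopology σ R)) :=
  @isFormalScheme_Spf R _ _ _ _ (powerSeriesTopology σ R) (isTopologicalRing_powerSeries σ R)

/-- The augmentation `R⟦x_s : s ∈ σ⟧ → R`, which sends all variables to zero. -/
noncomputable def augmentation : MvPowerSeries σ R →ₐ[R] R :=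
  { (MvPowerSeries.constantCoeff : MvPowerSeries σ R →+* R) with
    commutes' := fun r => by
      change MvPowerSeries.constantCoeff (algebraMap R (MvPowerSeries σ R) r) = r
      rw [MvPowerSeries.algebraMap_apply]
      simp }

theorem continuous_augmentation :
    @Continuous _ _ (powerSeriesTopology σ R) ⊥ (augmentation σ R) := by
  let _ : TopologicalSpace R := ⊥
  exact MvPowerSeries.WithPiTopology.continuous_constantCoeff R

/-- Formal affine `n`-space `Spf R⟦t_1, ..., t_n⟧`, pointed by the ideal `(t_1, ..., t_n)`. -/
noncomputable def formalAffineSpace (n : ℕ) : PointedFormalScheme R where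
  X := Spf R (MvPowerSeries (Fin n) R) (powerSeriesTopology (Fin n) R)
  isFormalScheme := isFormalScheme_Spf_powerSeries (Fin n) R
  pt := ⟨augmentation (Fin n) R, continuous_augmentation (Fin n) R⟩

end PowerSeries

section Witt

open MultiWitt

variable (n : ℕ) (R : Type u) [CommRing R]

/-- The functor of points `B ↦ Witt.small n B` of the additive formal group of `𝕎`. -/
noncomputable def wittFunctor : CommAlgCat.{u} R ⥤ AddCommGrpCat.{u} where
  obj B := AddCommGrpCat.of (Witt.small n B)
  map φ := AddCommGrpCat.ofHom (Witt.smallMap (φ.hom : _ →ₐ[R] _).toRingHom)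
  map_id B := by
    ext x
    rfl
  map_comp φ ψ := by
    ext x
    rfl

theorem hasEval_discrete {σ : Type} {B : Type u} [CommRing B] [TopologicalSpace B]
    [DiscreteTopology B] {a : σ → B} :
    MvPowerSeries.HasEval a ↔ (∀ s, IsNilpotent (a s)) ∧ {s | a s ≠ 0}.Finite := by
  rw [MvPowerSeries.hasEval_def]
  refine and_congr (forall_congr' fun s => ?_) ?_
  · rw [IsTopologicallyNilpotent, nhds_discrete, Filter.tendsto_pure, Filter.eventually_atTop]
    constructor
    · rintro ⟨N, h⟩
      exact ⟨N, h N le_rfl⟩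
    · rintro ⟨N, h⟩
      exact ⟨N, fun m hm => pow_eq_zero_of_le hm h⟩
  · rw [nhds_discrete, Filter.tendsto_pure, Filter.eventually_cofinite]

section Eval

open scoped MvPowerSeries.WithPiTopology

variable {R} {σ : Type} {B : Type u} [CommRing B] [Algebra R B]

theorem eval_hasEval (f : MvPowerSeries σ R →ₐ[R] B)
    (hf : @Continuous _ _ (powerSeriesTopology σ R) ⊥ f) :
    (∀ s, IsNilpotent (f (MvPowerSeries.X s))) ∧ {s | f (MvPowerSeries.X s) ≠ 0}.Finite := by
  let _ : TopologicalSpace R := ⊥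
  let _ : TopologicalSpace B := ⊥
  have : DiscreteTopology R := ⟨rfl⟩
  have : DiscreteTopology B := ⟨rfl⟩
  exact hasEval_discrete.1 (MvPowerSeries.HasEval.X.map (φ := f.toRingHom) hf)

theorem eval_injective {f g : MvPowerSeries σ R →ₐ[R] B}
    (hf : @Continuous _ _ (powerSeriesTopology σ R) ⊥ f)
    (hg : @Continuous _ _ (powerSeriesTopology σ R) ⊥ g)
    (h : ∀ s, f (MvPowerSeries.X s) = g (MvPowerSeries.X s)) : f = g := by
  let _ : UniformSpace R := ⊥
  let _ : UniformSpace B := ⊥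
  have : DiscreteUniformity R := ⟨rfl⟩
  have : DiscreteUniformity B := ⟨rfl⟩
  have : ContinuousSMul R B := ⟨continuous_of_discreteTopology⟩
  rw [← MvPowerSeries.aeval_unique (ε := f) hf, ← MvPowerSeries.aeval_unique (ε := g) hg]
  congr 1
  funext s
  exact h s

theorem eval_surjective {a : σ → B} (ha : (∀ s, IsNilpotent (a s)) ∧ {s | a s ≠ 0}.Finite) :
    ∃ f : MvPowerSeries σ R →ₐ[R] B, @Continuous _ _ (powerSeriesTopology σ R) ⊥ f ∧
      ∀ s, f (MvPowerSeries.X s) = a s := by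
  let _ : UniformSpace R := ⊥
  let _ : UniformSpace B := ⊥
  have : DiscreteUniformity R := ⟨rfl⟩
  have : DiscreteUniformity B := ⟨rfl⟩
  have : ContinuousSMul R B := ⟨continuous_of_discreteTopology⟩
  have h := hasEval_discrete.2 ha
  refine ⟨MvPowerSeries.aeval h, MvPowerSeries.continuous_aeval h, fun s => ?_⟩
  rw [← MvPolynomial.coe_X, MvPowerSeries.aeval_coe, MvPolynomial.aeval_X]

end Eval

/-- The underlying formal scheme of the additive formal group of `𝕎` is `Spf R⟦x_I⟧`, where `I` runs
over `ℤ_{≥0}^n - 0`. -/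
noncomputable def wittFunctorIso :
    Spf R (MvPowerSeries (Idx n) R) (powerSeriesTopology (Idx n) R) ≅
      wittFunctor n R ⋙ forget AddCommGrpCat :=
  NatIso.ofComponents (fun B => Equiv.toIso (Equiv.ofBijective
    (fun f => (⟨⟨fun I => f.1 (MvPowerSeries.X I)⟩, eval_hasEval f.1 f.2⟩ : Witt.small n B))
    ⟨fun f g h => Subtype.ext (eval_injective f.2 g.2 fun I =>
        congrFun (congrArg (fun t : Witt.small n B => t.1.coeff) h) I),
      fun x => by
        obtain ⟨f, hf, h⟩ := eval_surjective (R := R) x.2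
        exact ⟨⟨f, hf⟩, Subtype.ext (Witt.ext (funext h))⟩⟩))
    (fun φ => by
      ext f
      rfl)

/-- The additive formal group of the Witt vectors `𝕎` on `ℤ_{≥0}^n - 0`, over `R`. -/
noncomputable def wittFormalGroup : CommFormalGroup R where
  obj := wittFunctor n R
  property := (isFormalScheme_Spf_powerSeries (Idx n) R).map
    (Functor.whiskerLeft (unopUnop _) (wittFunctorIso n R).hom)

end Witt

end FormalGeometry

/-!
The universal curve sends a point `b` of formal affine space to the Witt vector `monomialVector b`,
whose component with index `I` is `b ^ I` if `gcd(I) = 1` and zero otherwise, so that its ghost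
components are all the monomials `b ^ I`. The isomorphism is restriction along this curve
(`restrict`); the point is that a curve `f` in a commutative formal group `G` extends uniquely to a
homomorphism from the formal group of `𝕎`.

Such a homomorphism has to send `∑_j monomialVector (c_j)` to `∑_j f (c_j)`. Let `t_1, ..., t_N` be
generic points, and let `theta` send the indeterminate `x_I` to the component with index `I` of
`∑_j monomialVector (t_j)`. After truncation in degrees `≥ N`, the map `theta` identifies `R[x_I]`
with the polynomials in the `t_{j,i}` that are invariant under permutations of the points
(`thetaTrunc_injective`, `exists_thetaTrunc_eq`). Both statements may be checked on other generators
of `R[x_I]`. If `R` is a `ℚ`-algebra these are the ghost components, which `theta` sends to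
polarized power sums: symmetrized monomials are polynomials in the power sums, and these are
independent in degrees below the number of points. If `n = 1` they are the coefficients of
`∏_d (1 - x_d T ^ d)`, which `theta` sends to the coefficients of `∏_j (1 - t_j T)` by comparison of
logarithmic derivatives with Newton's identities; then the fundamental theorem on symmetric
polynomials applies.

An ind-object preserves monomorphisms and equalizers. So the symmetric element `∑_j f (t_j)` of `G`
comes from a unique element over the truncation of `R[x_I]`, and specialization of the `x_I`
defines the extension of `f` (`extend`). It is additive, and unique, because every point of the
formal group of `𝕎` lifts to one that becomes a sum of vectors `monomialVector c_j` after an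
injective base change (`exists_splitting`).
-/

namespace FormalGeometry

/-! ### Formal schemes preserve monomorphisms and equalizers -/

section LeftExact

variable {R : Type u} [CommRing R] {X : CommAlgCat.{u} R ⥤ Type u}

/-- Any two `B`-points of a formal scheme factor through one and the same affine scheme. -/
theorem IsFormalScheme.exists_common_source (hX : IsFormalScheme R X) {B : CommAlgCat.{u} R}
    (x y : X.obj B) :
    ∃ (A : CommAlgCat.{u} R) (u : X.obj A) (α β : A ⟶ B), X.map α u = x ∧ X.map β u = y := by
  have := hX.isFiltered
  let c (x : X.obj B) : CostructuredArrow yoneda (unopUnop (CommAlgCat.{u} R) ⋙ X) :=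
    CostructuredArrow.mk (Y := Opposite.op B) (yonedaEquiv.symm x)
  let m := IsFiltered.max (c x) (c y)
  refine ⟨m.left.unop, yonedaEquiv m.hom, (IsFiltered.leftToMax (c x) (c y)).left.unop,
    (IsFiltered.rightToMax (c x) (c y)).left.unop, ?_, ?_⟩
  · have h := congrArg yonedaEquiv (CostructuredArrow.w (IsFiltered.leftToMax (c x) (c y)))
    rw [← yonedaEquiv_naturality] at h
    exact h.trans (Equiv.apply_symm_apply _ _)
  · have h := congrArg yonedaEquiv (CostructuredArrow.w (IsFiltered.rightToMax (c x) (c y)))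
    rw [← yonedaEquiv_naturality] at h
    exact h.trans (Equiv.apply_symm_apply _ _)

/-- If two morphisms from `Spec B` to an affine scheme over the formal scheme `X` agree in `X`, then
they agree in a further affine scheme over `X`. -/
theorem IsFormalScheme.exists_equalizing (hX : IsFormalScheme R X) {A B : CommAlgCat.{u} R}
    (α β : A ⟶ B) (u : X.obj A) (h : X.map α u = X.map β u) :
    ∃ (A' : CommAlgCat.{u} R) (γ : A' ⟶ A) (u' : X.obj A'), X.map γ u' = u ∧ γ ≫ α = γ ≫ β := by
  have := hX.isFiltered
  let c {A : CommAlgCat.{u} R} (x : X.obj A) :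
      CostructuredArrow yoneda (unopUnop (CommAlgCat.{u} R) ⋙ X) :=
    CostructuredArrow.mk (Y := Opposite.op A) (yonedaEquiv.symm x)
  let f : c (X.map α u) ⟶ c u := CostructuredArrow.homMk α.op (by
    apply yonedaEquiv.injective
    rw [← yonedaEquiv_naturality]
    simp [c])
  let g : c (X.map α u) ⟶ c u := CostructuredArrow.homMk β.op (by
    apply yonedaEquiv.injective
    rw [← yonedaEquiv_naturality]
    simp [c, h])
  refine ⟨(IsFiltered.coeq f g).left.unop, (IsFiltered.coeqHom f g).left.unop,
    yonedaEquiv (IsFiltered.coeq f g).hom, ?_, ?_⟩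
  · have h := congrArg yonedaEquiv (CostructuredArrow.w (IsFiltered.coeqHom f g))
    rw [← yonedaEquiv_naturality] at h
    exact h.trans (Equiv.apply_symm_apply _ _)
  · exact congrArg (fun t => t.left.unop) (IsFiltered.coeq_condition f g)

/-- A formal scheme takes injective homomorphisms to injective maps: as an ind-object it
preserves monomorphisms. -/
theorem IsFormalScheme.map_injective (hX : IsFormalScheme R X) {B C : CommAlgCat.{u} R}
    (ι : B ⟶ C) (hι : Function.Injective ι.hom) : Function.Injective (X.map ι) := by
  intro x y hxy
  obtain ⟨A, u, α, β, rfl, rfl⟩ := hX.exists_common_source x y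
  obtain ⟨A', γ, u', rfl, h⟩ := hX.exists_equalizing (α ≫ ι) (β ≫ ι) u (by simpa using hxy)
  have h1 : γ ≫ α = γ ≫ β := by
    ext a
    exact hι (congrArg (fun t => t.hom a) h)
  have h2 := congrArg (fun t => X.map t u') h1
  simpa using h2

/-- Points of a formal scheme that are invariant under finitely many endomorphisms `s i` of `C`
come from any subalgebra that contains the common invariants: an ind-object preserves
equalizers. -/
theorem IsFormalScheme.exists_of_invariant (hX : IsFormalScheme R X) {B C : CommAlgCat.{u} R}
    (ι : B ⟶ C) (hι : Function.Injective ι.hom) {S : Type*} [Finite S] (s : S → (C ⟶ C))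
    (hs : ∀ c : C, (∀ i, (s i).hom c = c) → ∃ b, ι.hom b = c)
    (x : X.obj C) (hx : ∀ i, X.map (s i) x = x) : ∃ y, X.map ι y = x := by
  classical
  have := Fintype.ofFinite S
  have key : ∀ T : Finset S, ∃ (A : CommAlgCat.{u} R) (γ : A ⟶ C) (u : X.obj A),
      X.map γ u = x ∧ ∀ i ∈ T, γ ≫ s i = γ := by
    intro T
    induction T using Finset.induction_on with
    | empty => exact ⟨C, 𝟙 C, x, by simp, by simp⟩
    | insert i T _ ih =>
      obtain ⟨A, γ, u, rfl, h⟩ := ih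
      obtain ⟨A', γ', u', rfl, h'⟩ := hX.exists_equalizing (γ ≫ s i) γ u (by simpa using hx i)
      refine ⟨A', γ' ≫ γ, u', by simp, fun j hj => ?_⟩
      rcases Finset.mem_insert.1 hj with rfl | hj
      · rw [Category.assoc, h']
      · rw [Category.assoc, h j hj]
  obtain ⟨A, γ, u, rfl, h⟩ := key Finset.univ
  have hγ : ∀ a : A, γ.hom a ∈ ι.hom.range := fun a => hs _ fun i =>
    congrArg (fun t => t.hom a) (h i (Finset.mem_univ i))
  let δ : A →ₐ[R] B := (AlgEquiv.ofInjective ι.hom hι).symm.toAlgHom.comp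
    (γ.hom.codRestrict ι.hom.range hγ)
  have hδ : CommAlgCat.ofHom δ ≫ ι = γ := by
    ext a
    have := congrArg Subtype.val
      ((AlgEquiv.ofInjective ι.hom hι).apply_symm_apply (γ.hom.codRestrict ι.hom.range hγ a))
    exact this
  refine ⟨X.map (CommAlgCat.ofHom δ) u, ?_⟩
  rw [← hδ]
  simp

end LeftExact

end FormalGeometry

namespace MultiWitt

/-! ### Polynomials of large weight -/

section WeightIdeal

open MvPolynomial

variable {σ τ : Type*} {R : Type*} [CommRing R]

/-- The ideal of the polynomials all of whose monomials have weight at least `N`, where the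
variable `v` has weight `w v`. -/
def weightIdeal (R : Type*) [CommRing R] (w : σ → ℕ) (N : ℕ) : Ideal (MvPolynomial σ R) where
  carrier := {p | ∀ d, Finsupp.weight w d < N → p.coeff d = 0}
  zero_mem' := fun d _ => coeff_zero d
  add_mem' := fun hp hq d hd => by rw [coeff_add, hp d hd, hq d hd, add_zero]
  smul_mem' := fun c p hp d hd => by
    classical
    rw [smul_eq_mul, coeff_mul]
    refine Finset.sum_eq_zero fun x hx => ?_
    rw [hp x.2 (lt_of_le_of_lt ?_ hd), mul_zero]
    rw [← Finset.HasAntidiagonal.mem_antidiagonal.1 hx, map_add]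
    exact Nat.le_add_left _ _

variable {w : σ → ℕ} {w' : τ → ℕ}

theorem mem_weightIdeal {N : ℕ} {p : MvPolynomial σ R} :
    p ∈ weightIdeal R w N ↔ ∀ d, Finsupp.weight w d < N → p.coeff d = 0 := Iff.rfl

theorem weightIdeal_anti {M N : ℕ} (h : M ≤ N) : weightIdeal R w N ≤ weightIdeal R w M :=
  fun _ hp d hd => hp d (hd.trans_le h)

theorem mem_weightIdeal_zero (p : MvPolynomial σ R) : p ∈ weightIdeal R w 0 :=
  fun _ hd => absurd hd (Nat.not_lt_zero _)

theorem mul_mem_weightIdeal {M N : ℕ} {p q : MvPolynomial σ R} (hp : p ∈ weightIdeal R w M)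
    (hq : q ∈ weightIdeal R w N) : p * q ∈ weightIdeal R w (M + N) := by
  classical
  intro d hd
  rw [coeff_mul]
  refine Finset.sum_eq_zero fun x hx => ?_
  rw [← Finset.HasAntidiagonal.mem_antidiagonal.1 hx, map_add] at hd
  by_cases h : Finsupp.weight w x.1 < M
  · rw [hp _ h, zero_mul]
  · rw [hq _ (by omega), mul_zero]

theorem pow_mem_weightIdeal {M : ℕ} {p : MvPolynomial σ R} (hp : p ∈ weightIdeal R w M) (k : ℕ) :
    p ^ k ∈ weightIdeal R w (k * M) := by
  induction k with
  | zero => rw [zero_mul]; exact mem_weightIdeal_zero _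
  | succ k ih => rw [pow_succ, Nat.succ_mul]; exact mul_mem_weightIdeal ih hp

theorem prod_mem_weightIdeal {ι : Type*} (s : Finset ι) (M : ι → ℕ) {p : ι → MvPolynomial σ R}
    (hp : ∀ i ∈ s, p i ∈ weightIdeal R w (M i)) :
    ∏ i ∈ s, p i ∈ weightIdeal R w (∑ i ∈ s, M i) := by
  classical
  induction s using Finset.induction_on with
  | empty => exact mem_weightIdeal_zero _
  | insert i s hi ih =>
    rw [Finset.prod_insert hi, Finset.sum_insert hi]
    exact mul_mem_weightIdeal (hp i (Finset.mem_insert_self i s))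
      (ih fun j hj => hp j (Finset.mem_insert_of_mem hj))

theorem X_mem_weightIdeal (v : σ) : (X v : MvPolynomial σ R) ∈ weightIdeal R w (w v) := by
  classical
  intro d hd
  rw [coeff_X, if_neg]
  rintro rfl
  rw [Finsupp.weight_single, one_smul] at hd
  exact hd.false

/-- Substitution of elements of the right weights does not lower weights. -/
theorem aeval_mem_weightIdeal {S : Type*} [CommRing S] [Algebra S (MvPolynomial τ R)]
    {b : σ → MvPolynomial τ R} (hb : ∀ v, b v ∈ weightIdeal R w' (w v)) {N : ℕ}
    {p : MvPolynomial σ S} (hp : p ∈ weightIdeal S w N) :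
    aeval b p ∈ weightIdeal R w' N := by
  rw [aeval_def, eval₂_eq]
  refine Ideal.sum_mem _ fun d hd => Ideal.mul_mem_left _ _ ?_
  have h : N ≤ Finsupp.weight w d := by
    by_contra h
    exact mem_support_iff.1 hd (hp d (not_le.1 h))
  refine weightIdeal_anti h ?_
  rw [Finsupp.weight_apply, Finsupp.sum]
  exact prod_mem_weightIdeal _ _ fun v _ => pow_mem_weightIdeal (hb v) _

/-- The part of a polynomial of weight less than `N`. -/
theorem exists_sub_mem_weightIdeal (w : σ → ℕ) (N : ℕ) (p : MvPolynomial σ R) :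
    ∃ q : MvPolynomial σ R, p - q ∈ weightIdeal R w N ∧
      ∀ d, q.coeff d = if Finsupp.weight w d < N then p.coeff d else 0 := by
  classical
  have h (d : σ →₀ ℕ) : (∑ m ∈ p.support with Finsupp.weight w m < N,
      monomial m (p.coeff m)).coeff d = if Finsupp.weight w d < N then p.coeff d else 0 := by
    rw [coeff_sum]
    simp only [coeff_monomial]
    rw [Finset.sum_ite_eq']
    simp only [Finset.mem_filter, mem_support_iff]
    grind
  refine ⟨_, fun d hd => ?_, h⟩
  rw [coeff_sub, h, if_pos hd, sub_self]

end WeightIdeal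

/-! ### Witt vectors of monomials -/

section Teichmuller

variable {n : ℕ} {A A' : Type*} [CommRing A] [CommRing A']

/-- The Witt vector attached to a point `b` of affine space: its component with index `I` is the
monomial `b ^ I` if `gcd(I) = 1`, and zero otherwise. Its ghost components are all the monomials;
for `n = 1` it is the Teichmüller representative. -/
def monomialVector (b : Fin n → A) : Witt n A :=
  ⟨fun I => if I.gcd = 1 then ∏ i, b i ^ I.1 i else 0⟩

theorem mapFun_monomialVector (φ : A →+* A') (b : Fin n → A) :
    Witt.mapFun φ (monomialVector b) = monomialVector (fun i => φ (b i)) := by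
  ext I
  change φ (if _ then _ else _) = if _ then _ else _
  split_ifs
  · simp
  · exact map_zero φ

/-- The pair `(gcd(I), I / gcd(I))`. -/
def Factor.primitive (I : Idx n) : Factor I :=
  ⟨(I.gcd, ⟨fun i => I.1 i / I.gcd, fun h => I.2 <| by
    funext i
    refine Nat.eq_zero_of_dvd_of_div_eq_zero ?_ (congrFun h i)
    exact Finset.gcd_dvd (Finset.mem_univ i)⟩), by
    funext i
    exact Nat.mul_div_cancel' (Finset.gcd_dvd (Finset.mem_univ i) : I.gcd ∣ I.1 i)⟩

theorem ghost_monomialVector (b : Fin n → A) (I : Idx n) :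
    (monomialVector b).ghost I = ∏ i, b i ^ I.1 i := by
  rw [Witt.ghost, Finset.sum_eq_single (Factor.primitive I)]
  · have hk : (Factor.primitive I).k = I.gcd := rfl
    have hJ : (Factor.primitive I).J.gcd = 1 := by
      have := (Factor.primitive I).k_mul_gcd
      rw [hk] at this
      exact Nat.eq_of_mul_eq_mul_left I.gcd_pos (by rw [this, mul_one])
    change ((Factor.primitive I).J.gcd : A) * (if (Factor.primitive I).J.gcd = 1 then
      ∏ i, b i ^ (Factor.primitive I).J.1 i else 0) ^ (Factor.primitive I).k = _
    rw [if_pos hJ, hJ, Nat.cast_one, one_mul, ← Finset.prod_pow]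
    refine Finset.prod_congr rfl fun i _ => ?_
    rw [← pow_mul, mul_comm]
    exact congrArg (b i ^ ·) (congrFun (Factor.primitive I).smul_eq i)
  · intro f _ hf
    change _ * (if f.J.gcd = 1 then _ else 0) ^ f.k = _
    rw [if_neg, zero_pow f.k_pos.ne', mul_zero]
    intro h
    apply hf
    apply Factor.k_injective
    have := f.k_mul_gcd
    rw [h, mul_one] at this
    exact this
  · simp

theorem isSmall_monomialVector {b : Fin n → A} (hb : ∀ i, IsNilpotent (b i)) :
    (monomialVector b).IsSmall := by
  choose K hK using hb
  constructor
  · intro I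
    change IsNilpotent (if _ then _ else _)
    split_ifs
    · obtain ⟨i, hi⟩ : ∃ i, I.1 i ≠ 0 := by
        by_contra! h
        exact I.2 (funext h)
      rw [← Finset.mul_prod_erase _ (fun j => b j ^ I.1 j) (Finset.mem_univ i)]
      exact (Commute.all _ _).isNilpotent_mul_right (IsNilpotent.pow_of_pos ⟨K i, hK i⟩ hi)
    · exact IsNilpotent.zero
  · refine (Idx.finite_deg_le n (∑ i, K i)).subset fun I hI => ?_
    change ∑ i, I.1 i ≤ ∑ i, K i
    refine Finset.sum_le_sum fun i _ => ?_
    by_contra h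
    apply hI
    change (if _ then _ else _) = _
    split_ifs
    · exact Finset.prod_eq_zero (Finset.mem_univ i) (pow_eq_zero_of_le (not_le.1 h).le (hK i))
    · rfl

theorem ghost_sum_monomialVector {k : ℕ} (b : Fin k → Fin n → A) (I : Idx n) :
    (∑ j, monomialVector (b j)).ghost I = ∑ j, ∏ i, b j i ^ I.1 i := by
  have h := congrFun (map_sum (Witt.ghostHom (n := n) (B := A)) (fun j => monomialVector (b j))
    Finset.univ) I
  rw [Finset.sum_apply] at h
  exact h.trans (Finset.sum_congr rfl fun j _ => ghost_monomialVector (b j) I)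

theorem mapFun_sum_monomialVector (φ : A →+* A') {k : ℕ} (b : Fin k → Fin n → A) :
    Witt.mapFun φ (∑ j, monomialVector (b j)) = ∑ j, monomialVector fun i => φ (b j i) :=
  (map_sum (Witt.map φ) _ _).trans
    (Finset.sum_congr rfl fun j _ => mapFun_monomialVector φ (b j))

end Teichmuller

/-! ### The sum of generic monomial vectors -/

section Theta

open MvPolynomial

variable (n N : ℕ) (R : Type*) [CommRing R]

/-- The sum of the Witt vectors `monomialVector t_j` of `N` generic points
`t_j = (t_{j,1}, ..., t_{j,n})` of affine space. -/
noncomputable def genericSum : Witt n (MvPolynomial (Fin N × Fin n) R) :=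
  ∑ j, monomialVector fun i => X (j, i)

/-- The homomorphism `R[x_I] → R[t_{j,i}]` that sends `x_I` to the component with index `I` of the
generic sum. -/
noncomputable def theta : MvPolynomial (Idx n) R →ₐ[R] MvPolynomial (Fin N × Fin n) R :=
  aeval (genericSum n N R).coeff

theorem coeff_add_mem_weightIdeal {σ : Type*} {w : σ → ℕ} {x y : Witt n (MvPolynomial σ R)}
    (hx : ∀ I, x.coeff I ∈ weightIdeal R w I.deg) (hy : ∀ I, y.coeff I ∈ weightIdeal R w I.deg)
    (I : Idx n) : (x + y).coeff I ∈ weightIdeal R w I.deg := by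
  refine aeval_mem_weightIdeal (w := fun v : Fin 2 × Idx n => v.2.deg) ?_
    fun d hd => (add_homogeneous I).coeff_eq_zero d hd.ne
  rintro ⟨i, J⟩
  fin_cases i
  exacts [hx J, hy J]

theorem genericSum_coeff_mem (I : Idx n) :
    (genericSum n N R).coeff I ∈ weightIdeal R (fun _ => 1) I.deg := by
  classical
  have key : ∀ (s : Finset (Fin N)) (I : Idx n),
      (∑ j ∈ s, monomialVector fun i => (X (j, i) : MvPolynomial (Fin N × Fin n) R)).coeff I ∈
        weightIdeal R (fun _ => 1) I.deg := by
    intro s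
    induction s using Finset.induction_on with
    | empty => exact fun I => Ideal.zero_mem _
    | insert j s hj ih =>
      rw [Finset.sum_insert hj]
      refine coeff_add_mem_weightIdeal n R (fun I => ?_) ih
      change (if _ then _ else _) ∈ _
      split_ifs
      · refine prod_mem_weightIdeal _ I.1 fun i _ => ?_
        have := pow_mem_weightIdeal (R := R) (w := fun _ => 1)
          (X_mem_weightIdeal ((j, i) : Fin N × Fin n)) (I.1 i)
        rwa [mul_one] at this
      · exact Ideal.zero_mem _
  exact key _ I

theorem theta_mem_weightIdeal {M : ℕ} {p : MvPolynomial (Idx n) R}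
    (hp : p ∈ weightIdeal R Idx.deg M) : theta n N R p ∈ weightIdeal R (fun _ => 1) M :=
  aeval_mem_weightIdeal (genericSum_coeff_mem n N R) hp

end Theta

/-! ### Polarized power sums in characteristic zero -/

section PowerSums

open MvPolynomial

variable (n N : ℕ) {R : Type*} [CommRing R]

theorem isUnit_natCast_of_algebra_rat [Algebra ℚ R] {m : ℕ} (hm : m ≠ 0) : IsUnit (m : R) := by
  have h : IsUnit (m : ℚ) := by simpa using hm
  simpa using h.map (algebraMap ℚ R)

variable {n N}

variable (R) in
/-- The monomial `t_j ^ J`. -/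
noncomputable def blockMonomial (j : Fin N) (J : Fin n → ℕ) : MvPolynomial (Fin N × Fin n) R :=
  ∏ i, X (j, i) ^ J i

variable (N R) in
/-- The polarized power sum `∑_j t_j ^ J`. -/
noncomputable def powerSum (J : Fin n → ℕ) : MvPolynomial (Fin N × Fin n) R :=
  ∑ j, blockMonomial R j J

variable (R) in
/-- The symmetrization of the product of the monomials `t_i ^ (I i)` for `i ∈ s`. -/
noncomputable def symmetrization (s : Finset (Fin N)) (I : Fin N → Fin n → ℕ) :
    MvPolynomial (Fin N × Fin n) R :=
  ∑ σ : Equiv.Perm (Fin N), ∏ i ∈ s, blockMonomial R (σ i) (I i)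

theorem blockMonomial_add (j : Fin N) (J J' : Fin n → ℕ) :
    blockMonomial R j (J + J') = blockMonomial R j J * blockMonomial R j J' := by
  simp [blockMonomial, pow_add, Finset.prod_mul_distrib]

/-- The index `i` of the additional factor may be replaced by `i₀`, as the sum runs over all
permutations. -/
theorem symmetrization_insert_swap {s : Finset (Fin N)} {i₀ i : Fin N} (h₀ : i₀ ∉ s) (hi : i ∉ s)
    (I : Fin N → Fin n → ℕ) :
    ∑ σ : Equiv.Perm (Fin N), blockMonomial R (σ i) (I i₀) *
      ∏ l ∈ s, blockMonomial R (σ l) (I l) = symmetrization R (insert i₀ s) I := by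
  rw [symmetrization]
  refine Fintype.sum_equiv (Equiv.mulRight (Equiv.swap i₀ i)) _ _ fun σ => ?_
  rw [Finset.prod_insert h₀]
  congr 1
  · simp
  · refine Finset.prod_congr rfl fun l hl => ?_
    have h1 : l ≠ i₀ := fun h => h₀ (h ▸ hl)
    have h2 : l ≠ i := fun h => hi (h ▸ hl)
    simp [Equiv.swap_apply_of_ne_of_ne h1 h2]

theorem powerSum_mul_symmetrization {s : Finset (Fin N)} {i₀ : Fin N} (h₀ : i₀ ∉ s)
    (I : Fin N → Fin n → ℕ) :
    powerSum N R (I i₀) * symmetrization R s I =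
      ∑ i ∈ s, symmetrization R s (Function.update I i (I i + I i₀)) +
        ((N - s.card : ℕ) : MvPolynomial (Fin N × Fin n) R) *
          symmetrization R (insert i₀ s) I := by
  classical
  have h1 : powerSum N R (I i₀) * symmetrization R s I = ∑ i, ∑ σ : Equiv.Perm (Fin N),
      blockMonomial R (σ i) (I i₀) * ∏ l ∈ s, blockMonomial R (σ l) (I l) := by
    rw [symmetrization, Finset.mul_sum, Finset.sum_comm]
    refine Finset.sum_congr rfl fun σ _ => ?_
    rw [← Finset.sum_mul]
    congr 1
    exact (Equiv.sum_comp σ fun j => blockMonomial R j (I i₀)).symm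
  rw [h1, ← Finset.sum_add_sum_compl s]
  congr 1
  · refine Finset.sum_congr rfl fun i hi => Finset.sum_congr rfl fun σ _ => ?_
    rw [← Finset.mul_prod_erase s _ hi, ← Finset.mul_prod_erase s _ hi, Function.update_self,
      blockMonomial_add, ← mul_assoc, mul_comm (blockMonomial R (σ i) (I i₀))]
    congr 1
    refine Finset.prod_congr rfl fun l hl => ?_
    rw [Function.update_of_ne (Finset.ne_of_mem_erase hl)]
  · rw [Finset.sum_congr rfl fun i hi => symmetrization_insert_swap h₀ (Finset.mem_compl.1 hi) I,
      Finset.sum_const, nsmul_eq_mul, Finset.card_compl, Fintype.card_fin]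

theorem powerSum_mem_adjoin (J : Fin n → ℕ) :
    powerSum N R J ∈ Algebra.adjoin R (Set.range fun I : Idx n => powerSum N R I.1) := by
  by_cases hJ : J = 0
  · subst hJ
    simp [powerSum, blockMonomial]
  · exact Algebra.subset_adjoin ⟨⟨J, hJ⟩, rfl⟩

/-- In characteristic zero, symmetrized monomials are polynomials in the power sums: multiplying
the symmetrization of a product of fewer monomials by a power sum adds one factor, up to an integer
multiple and up to terms with fewer factors. -/
theorem symmetrization_mem_adjoin [Algebra ℚ R] (s : Finset (Fin N)) (I : Fin N → Fin n → ℕ) :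
    symmetrization R s I ∈
      Algebra.adjoin R (Set.range fun I : Idx n => powerSum N R I.1) := by
  classical
  induction s using Finset.induction_on generalizing I with
  | empty => simp [symmetrization]
  | insert i₀ s h₀ ih =>
    have h1 := powerSum_mul_symmetrization (R := R) h₀ I
    have hcard : N - s.card ≠ 0 := by
      have := Finset.card_le_univ (insert i₀ s)
      rw [Finset.card_insert_of_notMem h₀, Fintype.card_fin] at this
      omega
    obtain ⟨v, hv⟩ := (isUnit_natCast_of_algebra_rat (R := R) hcard).exists_left_inv
    have h2 : symmetrization R (insert i₀ s) I = v • (powerSum N R (I i₀) * symmetrization R s I -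
        ∑ i ∈ s, symmetrization R s (Function.update I i (I i + I i₀))) := by
      rw [h1, add_sub_cancel_left, ← nsmul_eq_mul, ← Nat.cast_smul_eq_nsmul R, smul_smul, hv,
        one_smul]
    rw [h2]
    exact Subalgebra.smul_mem _ (Subalgebra.sub_mem _
      (Subalgebra.mul_mem _ (powerSum_mem_adjoin _) (ih _))
      (Subalgebra.sum_mem _ fun i _ => ih _)) _

theorem rename_monomial_eq_prod (σ : Equiv.Perm (Fin N)) (d : Fin N × Fin n →₀ ℕ) :
    rename (Prod.map σ id) (monomial d (1 : R)) =
      ∏ j, blockMonomial R (σ j) fun i => d (j, i) := by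
  rw [monomial_eq, C_1, one_mul, Finsupp.prod_fintype _ _ (fun _ => pow_zero _), map_prod,
    Fintype.prod_prod_type]
  refine Finset.prod_congr rfl fun j _ => Finset.prod_congr rfl fun i _ => ?_
  rw [map_pow, rename_X]
  rfl

/-- A symmetric polynomial is, up to the factor `N!`, the sum of its transforms under all
permutations, hence a combination of symmetrized monomials. -/
theorem mem_adjoin_powerSum [Algebra ℚ R] {q : MvPolynomial (Fin N × Fin n) R}
    (hq : ∀ σ : Equiv.Perm (Fin N), rename (Prod.map σ id) q = q) :
    q ∈ Algebra.adjoin R (Set.range fun I : Idx n => powerSum N R I.1) := by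
  have h1 : (N.factorial : R) • q = ∑ d ∈ q.support, q.coeff d •
      symmetrization R Finset.univ fun j i => d (j, i) := by
    have hcard : N.factorial = (Finset.univ : Finset (Equiv.Perm (Fin N))).card := by
      rw [Finset.card_univ, Fintype.card_perm, Fintype.card_fin]
    rw [Nat.cast_smul_eq_nsmul, hcard, ← Finset.sum_const,
      ← Finset.sum_congr rfl fun σ _ => hq σ]
    conv_lhs => enter [2, σ]; rw [q.as_sum, map_sum]
    rw [Finset.sum_comm]
    refine Finset.sum_congr rfl fun d _ => ?_
    rw [symmetrization, Finset.smul_sum]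
    refine Finset.sum_congr rfl fun σ _ => ?_
    rw [← rename_monomial_eq_prod, ← map_smul, smul_monomial, smul_eq_mul, mul_one]
  obtain ⟨v, hv⟩ :=
    (isUnit_natCast_of_algebra_rat (R := R) N.factorial_ne_zero).exists_left_inv
  rw [← one_smul R q, ← hv, mul_smul, h1]
  exact Subalgebra.smul_mem _ (Subalgebra.sum_mem _ fun d _ =>
    Subalgebra.smul_mem _ (symmetrization_mem_adjoin _ _) _) _

/-- The exponent of the monomial `t_j ^ J`. -/
noncomputable def blockExponent (j : Fin N) (J : Fin n → ℕ) : Fin N × Fin n →₀ ℕ :=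
  ∑ i, Finsupp.single (j, i) (J i)

theorem blockExponent_apply (j j' : Fin N) (J : Fin n → ℕ) (i : Fin n) :
    blockExponent j J (j', i) = if j = j' then J i else 0 := by
  classical
  rw [blockExponent, Finsupp.finsetSum_apply]
  split_ifs with h
  · subst h
    rw [Finset.sum_eq_single i (fun l _ hl => by simp [hl]) (by simp)]
    simp
  · exact Finset.sum_eq_zero fun l _ => by simp [h]

theorem weight_blockExponent (j : Fin N) (J : Idx n) :
    Finsupp.weight (fun _ => 1) (blockExponent j J.1) = J.deg := by
  simp [blockExponent, Finsupp.weight_single, Idx.deg]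

theorem blockMonomial_eq (j : Fin N) (J : Fin n → ℕ) :
    blockMonomial R j J = monomial (blockExponent j J) 1 := by
  rw [blockExponent, monomial_sum_one]
  exact Finset.prod_congr rfl fun i _ => X_pow_eq_monomial

/-- If two products of monomials `t_j ^ J`, the second one with distinct `j` and with at least as
many factors as the first, are equal, then the same exponents `J` occur in both. -/
theorem sum_single_eq_of_sum_blockExponent_eq {S S' : Type*} [Fintype S] [Fintype S']
    (a : S' → Fin N) (e : S ↪ Fin N) (L' : S' → Idx n) (L : S → Idx n)
    (hcard : Fintype.card S' ≤ Fintype.card S)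
    (h : ∑ s, blockExponent (a s) (L' s).1 = ∑ s, blockExponent (e s) (L s).1) :
    ∑ s, Finsupp.single (L' s) 1 = ∑ s, Finsupp.single (L s) 1 := by
  classical
  have h1 (j : Fin N) (i : Fin n) : (∑ s, if a s = j then (L' s).1 i else 0) =
      ∑ s, if e s = j then (L s).1 i else 0 := by
    have := DFunLike.congr_fun h (j, i)
    simpa only [Finsupp.finsetSum_apply, blockExponent_apply] using this
  have h2 (s : S) (i : Fin n) : (∑ s', if a s' = e s then (L' s').1 i else 0) = (L s).1 i := by
    rw [h1, Finset.sum_eq_single s]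
    · simp
    · intro s' _ hs
      rw [if_neg fun h => hs (e.injective h)]
    · simp
  have h3 (s : S) : ∃ s', a s' = e s := by
    by_contra! h
    refine (L s).2 (funext fun i => ?_)
    rw [← h2 s i]
    exact Finset.sum_eq_zero fun s' _ => if_neg (h s')
  choose g hg using h3
  have hinj : Function.Injective g := fun s s' hs => e.injective (by rw [← hg, ← hg, hs])
  have hbij : Function.Bijective g :=
    (Fintype.bijective_iff_injective_and_card g).2
      ⟨hinj, le_antisymm (Fintype.card_le_of_injective g hinj) hcard⟩
  refine (Fintype.sum_bijective g hbij _ _ fun s => ?_).symm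
  congr 1
  refine Subtype.ext (funext fun i => ?_)
  rw [← h2 s i, Finset.sum_eq_single (g s)]
  · rw [if_pos (hg s)]
  · intro s' _ hs'
    obtain ⟨s'', rfl⟩ := hbij.2 s'
    rw [if_neg]
    intro h
    rw [hg] at h
    exact hs' (congrArg g (e.injective h))
  · simp

/-- The elements of the multiset with multiplicity function `μ`, with repetitions. -/
abbrev Copies {σ : Type*} (μ : σ →₀ ℕ) : Type _ := Σ v : μ.support, Fin (μ v)

theorem sum_copies {σ M : Type*} [AddCommMonoid M] (μ : σ →₀ ℕ) (f : σ → M) :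
    ∑ s : Copies μ, f s.1 = μ.sum fun v m => m • f v := by
  rw [Fintype.sum_sigma, Finsupp.sum, ← Finset.sum_coe_sort μ.support fun v => μ v • f v]
  simp

theorem prod_copies {σ M : Type*} [CommMonoid M] (μ : σ →₀ ℕ) (f : σ → M) :
    ∏ s : Copies μ, f s.1 = μ.prod fun v m => f v ^ m := by
  rw [Fintype.prod_sigma, Finsupp.prod, ← Finset.prod_coe_sort μ.support fun v => f v ^ μ v]
  simp

theorem sum_single_copies {σ : Type*} (μ : σ →₀ ℕ) :
    ∑ s : Copies μ, Finsupp.single s.1.1 1 = μ := by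
  rw [sum_copies μ fun v => Finsupp.single v 1]
  simp

open Classical in
theorem coeff_prod_powerSum (μ : Idx n →₀ ℕ) (D : Fin N × Fin n →₀ ℕ) :
    (μ.prod fun I m => powerSum N R I.1 ^ m).coeff D =
      ((Finset.univ.filter fun a : Copies μ → Fin N =>
        ∑ s, blockExponent (a s) s.1.1.1 = D).card : R) := by
  rw [← prod_copies μ fun I => powerSum N R I.1]
  simp only [powerSum, blockMonomial_eq]
  rw [Finset.prod_univ_sum, Fintype.piFinset_univ, coeff_sum, Finset.card_filter, Nat.cast_sum]
  refine Finset.sum_congr rfl fun a _ => ?_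
  rw [← monomial_sum_one, coeff_monomial]
  split_ifs <;> simp

/-- In characteristic zero, the power sums of `N` points satisfy no relations in degrees
below `N`. -/
theorem mem_weightIdeal_of_aeval_powerSum [Algebra ℚ R] {p : MvPolynomial (Idx n) R}
    (hp : aeval (fun I : Idx n => powerSum N R I.1) p ∈ weightIdeal R (fun _ => 1) N) :
    p ∈ weightIdeal R Idx.deg N := by
  classical
  by_contra hcon
  have hne : (p.support.filter fun μ => Finsupp.weight Idx.deg μ < N).Nonempty := by
    simp only [mem_weightIdeal, not_forall] at hcon
    obtain ⟨μ, hμ, h0⟩ := hcon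
    exact ⟨μ, Finset.mem_filter.2 ⟨mem_support_iff.2 h0, hμ⟩⟩
  -- among the monomials of small weight choose one with as many factors as possible
  obtain ⟨ν, hν, hmax⟩ := Finset.exists_max_image _ (fun μ => Fintype.card (Copies μ)) hne
  obtain ⟨hνp, hνN⟩ := Finset.mem_filter.1 hν
  have hweight (μ : Idx n →₀ ℕ) (a : Copies μ → Fin N) :
      Finsupp.weight (fun _ => 1) (∑ s, blockExponent (a s) s.1.1.1) =
        Finsupp.weight Idx.deg μ := by
    rw [map_sum, Finset.sum_congr rfl fun s _ => weight_blockExponent (a s) s.1.1,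
      sum_copies μ Idx.deg, Finsupp.weight_apply]
  have hcard : Fintype.card (Copies ν) ≤ Fintype.card (Fin N) := by
    rw [Fintype.card_fin]
    refine le_trans ?_ hνN.le
    rw [Finsupp.weight_apply, ← sum_copies ν Idx.deg, ← Finset.card_univ, Finset.card_eq_sum_ones]
    exact Finset.sum_le_sum fun s _ => s.1.1.deg_pos
  obtain ⟨e⟩ := Function.Embedding.nonempty_of_card_le hcard
  -- the coefficient of a monomial with these factors in distinct blocks
  have h1 := hp (∑ s, blockExponent (e s) s.1.1.1) (by rwa [hweight ν e])
  rw [aeval_def, eval₂_eq, coeff_sum, Finset.sum_eq_single ν] at h1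
  · rw [algebraMap_eq, coeff_C_mul] at h1
    have h2 := coeff_prod_powerSum (R := R) ν (∑ s, blockExponent (e s) s.1.1.1)
    rw [Finsupp.prod] at h2
    rw [h2] at h1
    refine mem_support_iff.1 hνp ((isUnit_natCast_of_algebra_rat ?_).mul_left_eq_zero.1 h1)
    exact Finset.card_ne_zero_of_mem (Finset.mem_filter.2 ⟨Finset.mem_univ (e : _ → _), rfl⟩)
  · intro μ hμ hμν
    rw [algebraMap_eq, coeff_C_mul]
    have h2 := coeff_prod_powerSum (R := R) μ (∑ s, blockExponent (e s) s.1.1.1)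
    rw [Finsupp.prod] at h2
    rw [h2, Finset.filter_eq_empty_iff.2, Finset.card_empty, Nat.cast_zero, mul_zero]
    intro a _ ha
    have h3 : Fintype.card (Copies μ) ≤ Fintype.card (Copies ν) :=
      hmax μ (Finset.mem_filter.2 ⟨hμ, by rwa [← hweight μ a, ha, hweight ν e]⟩)
    have h4 := sum_single_eq_of_sum_blockExponent_eq a e (fun s => s.1.1) (fun s => s.1.1) h3 ha
    rw [sum_single_copies, sum_single_copies] at h4
    exact hμν h4
  · exact fun h => absurd hνp h

end PowerSums

/-! ### The product of the factors `1 - x_d T ^ d` -/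

section EulerProduct

open PowerSeries

variable {A A' : Type*} [CommRing A] [CommRing A']

/-- The index `d + 1` in `ℤ_{≥0}^1 - 0`. -/
def Idx.ofSucc (d : ℕ) : Idx 1 := ⟨fun _ => d + 1, fun h => d.succ_ne_zero (congrFun h 0)⟩

theorem Idx.deg_ofSucc (d : ℕ) : (Idx.ofSucc d).deg = d + 1 := by
  simp [Idx.deg, Idx.ofSucc]

theorem Idx.deg_eq (I : Idx 1) : I.deg = I.1 0 := by
  simp [Idx.deg]

theorem Idx.gcd_eq (I : Idx 1) : I.gcd = I.1 0 := by
  simp [Idx.gcd]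

theorem Idx.ofSucc_of_deg {I : Idx 1} {d : ℕ} (h : I.deg = d + 1) : Idx.ofSucc d = I := by
  refine Subtype.ext (funext fun i => ?_)
  rw [Subsingleton.elim i 0, ← I.deg_eq, h]
  rfl

/-- The power series `∏_{1 ≤ d ≤ M} (1 - x_d T ^ d)`. -/
noncomputable def eulerProduct (x : Witt 1 A) (M : ℕ) : PowerSeries A :=
  ∏ d ∈ Finset.range M, (1 - C (x.coeff (Idx.ofSucc d)) * X ^ (d + 1))

theorem map_eulerProduct (φ : A →+* A') (x : Witt 1 A) (M : ℕ) :
    PowerSeries.map φ (eulerProduct x M) = eulerProduct (Witt.mapFun φ x) M := by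
  rw [eulerProduct, map_prod, eulerProduct]
  refine Finset.prod_congr rfl fun d _ => ?_
  simp [Witt.mapFun]

/-- The negative of the logarithmic derivative (with respect to `T d/dT`) of `1 - c T ^ e`, which is
`∑_{k ≥ 1} e c ^ k T ^ (e k)`. -/
noncomputable def eulerFactorLog (e : ℕ) (c : A) : PowerSeries A :=
  PowerSeries.mk fun m => if e ∣ m ∧ m ≠ 0 then (e : A) * c ^ (m / e) else 0

theorem coeff_X_mul_derivative (f : PowerSeries A) (m : ℕ) :
    coeff m (X * derivative A f) = m * coeff m f := by
  cases m with
  | zero => simp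
  | succ m =>
    rw [coeff_succ_X_mul, coeff_derivative, mul_comm]
    push_cast
    rfl

theorem X_mul_derivative_eulerFactor {e : ℕ} (he : 0 < e) (c : A) :
    X * derivative A (1 - C c * X ^ e) = -((1 - C c * X ^ e) * eulerFactorLog e c) := by
  ext m
  rw [coeff_X_mul_derivative, sub_mul, one_mul, map_neg, map_sub, map_sub, mul_assoc,
    coeff_C_mul, coeff_C_mul, coeff_X_pow_mul', coeff_X_pow, coeff_one, eulerFactorLog, coeff_mk,
    coeff_mk]
  rcases Nat.lt_trichotomy m e with h | rfl | h
  · rw [if_neg (show ¬ m = e by omega), if_neg (show ¬ e ≤ m by omega)]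
    by_cases h0 : m = 0
    · simp [h0]
    · rw [if_neg h0, if_neg fun h' => absurd (Nat.le_of_dvd (Nat.pos_of_ne_zero h0) h'.1)
        (not_le.2 h)]
      simp
  · simp [he.ne', Nat.div_self he]
  · rw [if_neg (show ¬ m = e by omega), if_pos h.le, if_neg (show ¬ m = 0 by omega)]
    by_cases hd : e ∣ m
    · obtain ⟨k, rfl⟩ := hd
      have hk : 1 < k := by
        by_contra hk
        have : e * k ≤ e * 1 := Nat.mul_le_mul_left e (not_lt.1 hk)
        omega
      obtain ⟨k, rfl⟩ := Nat.exists_eq_add_of_lt hk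
      have h1 : e * (1 + k + 1) - e = e * (k + 1) := by
        rw [show 1 + k + 1 = (k + 1) + 1 by ring, Nat.mul_succ, Nat.add_sub_cancel]
      rw [h1, if_pos ⟨dvd_mul_right _ _, by positivity⟩, if_pos ⟨dvd_mul_right _ _, by positivity⟩,
        Nat.mul_div_cancel_left _ he, Nat.mul_div_cancel_left _ he]
      ring
    · rw [if_neg fun h' => hd h'.1,
        if_neg fun h' => hd ((Nat.dvd_sub_iff_left h.le dvd_rfl).1 h'.1)]
      simp

theorem X_mul_derivative_eulerProduct (x : Witt 1 A) (M : ℕ) :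
    X * derivative A (eulerProduct x M) = -(eulerProduct x M *
      ∑ d ∈ Finset.range M, eulerFactorLog (d + 1) (x.coeff (Idx.ofSucc d))) := by
  induction M with
  | zero => simp [eulerProduct]
  | succ M ih =>
    rw [eulerProduct, Finset.prod_range_succ, Finset.sum_range_succ, Derivation.leibniz,
      smul_eq_mul, smul_eq_mul]
    have h := X_mul_derivative_eulerFactor (Nat.add_pos_right M one_pos) (x.coeff (Idx.ofSucc M))
    rw [eulerProduct] at ih
    linear_combination (∏ d ∈ Finset.range M, (1 - C (x.coeff (Idx.ofSucc d)) * X ^ (d + 1))) * h +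
      (1 - C (x.coeff (Idx.ofSucc M)) * X ^ (M + 1)) * ih

/-- The coefficients of the negative logarithmic derivative of the product are the ghost
components. -/
theorem coeff_sum_eulerFactorLog (x : Witt 1 A) {m M : ℕ} (hm : m < M) :
    coeff (m + 1) (∑ d ∈ Finset.range M, eulerFactorLog (d + 1) (x.coeff (Idx.ofSucc d))) =
      x.ghost (Idx.ofSucc m) := by
  classical
  rw [map_sum, Witt.ghost]
  simp only [eulerFactorLog, coeff_mk]
  rw [← Finset.sum_filter]
  have hJ (f : Factor (Idx.ofSucc m)) : f.k * f.J.1 0 = m + 1 := congrFun f.smul_eq 0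
  have hpos (f : Factor (Idx.ofSucc m)) : f.J.1 0 - 1 + 1 = f.J.1 0 := by
    have := f.J.gcd_pos
    rw [f.J.gcd_eq] at this
    omega
  have hofSucc (f : Factor (Idx.ofSucc m)) : Idx.ofSucc (f.J.1 0 - 1) = f.J :=
    Idx.ofSucc_of_deg (by rw [f.J.deg_eq, hpos])
  symm
  refine Finset.sum_bij (fun f _ => f.J.1 0 - 1) (fun f _ => ?_) (fun f _ g _ h => ?_)
    (fun d hd => ?_) (fun f _ => ?_)
  · have h1 : f.J.1 0 ∣ m + 1 := ⟨f.k, by rw [mul_comm, hJ]⟩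
    have h2 := Nat.le_of_dvd m.succ_pos h1
    refine Finset.mem_filter.2 ⟨Finset.mem_range.2 ?_, ?_, m.succ_ne_zero⟩
    · have := hpos f
      omega
    · rwa [hpos]
  · apply Factor.k_injective
    have h1 : f.J.1 0 = g.J.1 0 := by rw [← hpos f, ← hpos g, h]
    have h2 := hJ f
    rw [← hJ g, h1] at h2
    exact Nat.eq_of_mul_eq_mul_right (by have := hpos g; omega) h2
  · obtain ⟨k, hk⟩ := (Finset.mem_filter.1 hd).2.1
    refine ⟨⟨(k, Idx.ofSucc d), ?_⟩, Finset.mem_univ _, rfl⟩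
    funext i
    change k * (d + 1) = m + 1
    rw [hk, mul_comm]
  · rw [hofSucc, hpos, f.J.gcd_eq]
    congr 2
    rw [← hJ f, Nat.mul_div_cancel]
    have := hpos f
    omega

theorem natCast_mul_coeff_eulerProduct (x : Witt 1 A) {m M : ℕ} (hm : m ≤ M) :
    m * coeff m (eulerProduct x M) = -∑ a ∈ Finset.HasAntidiagonal.antidiagonal m with a.1 < m,
      coeff a.1 (eulerProduct x M) * x.ghost (Idx.ofSucc (a.2 - 1)) := by
  rw [← coeff_X_mul_derivative, X_mul_derivative_eulerProduct, map_neg, coeff_mul,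
    Finset.sum_filter]
  congr 1
  refine Finset.sum_congr rfl fun a ha => ?_
  have ha' := Finset.HasAntidiagonal.mem_antidiagonal.1 ha
  split_ifs with h
  · obtain ⟨j, hj⟩ : ∃ j, a.2 = j + 1 := ⟨a.2 - 1, by omega⟩
    rw [hj, coeff_sum_eulerFactorLog x (by omega), Nat.add_sub_cancel]
  · have : a.2 = 0 := by omega
    rw [this, map_sum, Finset.sum_eq_zero, mul_zero]
    intro d _
    simp [eulerFactorLog]

/-- The product `∏_d (1 - x_d T ^ d)` of a sum of Teichmüller representatives is the polynomial
`∏_j (1 - b_j T)`, over a ring without torsion: both satisfy Newton's identities. -/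
theorem coeff_eulerProduct_generic (k : ℕ) {m M : ℕ} (hm : m ≤ M) :
    coeff m (eulerProduct (∑ j, monomialVector fun _ : Fin 1 =>
      (MvPolynomial.X j : MvPolynomial (Fin k) ℤ)) M) =
        (-1) ^ m * MvPolynomial.esymm (Fin k) ℤ m := by
  induction m using Nat.strong_induction_on with
  | _ m ih =>
    rcases Nat.eq_zero_or_pos m with rfl | hpos
    · rw [coeff_zero_eq_constantCoeff_apply, eulerProduct, map_prod]
      simp
    · have h1 := natCast_mul_coeff_eulerProduct (∑ j, monomialVector fun _ : Fin 1 =>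
        (MvPolynomial.X j : MvPolynomial (Fin k) ℤ)) hm
      have h2 := MvPolynomial.mul_esymm_eq_sum (Fin k) ℤ m
      have h3 : (m : MvPolynomial (Fin k) ℤ) ≠ 0 := by exact_mod_cast hpos.ne'
      refine mul_left_cancel₀ h3 (h1.trans ?_)
      rw [mul_left_comm, h2, ← mul_assoc, ← pow_add, ← add_assoc, ← two_mul, pow_succ, pow_mul,
        neg_one_sq, one_pow, one_mul, neg_one_mul, neg_inj]
      refine Finset.sum_congr rfl fun a ha => ?_
      obtain ⟨ha1, ha2⟩ := Finset.mem_filter.1 ha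
      have ha' := Finset.HasAntidiagonal.mem_antidiagonal.1 ha1
      rw [ih a.1 ha2 (by omega), ghost_sum_monomialVector]
      congr 1
      refine Finset.sum_congr rfl fun j _ => ?_
      simp only [Finset.univ_unique, Finset.prod_singleton, Idx.ofSucc]
      rw [Nat.sub_add_cancel (by omega)]

theorem coeff_eulerProduct_sum {k : ℕ} (b : Fin k → A) {m M : ℕ} (hm : m ≤ M) :
    coeff m (eulerProduct (∑ j, monomialVector fun _ : Fin 1 => b j) M) =
      (-1) ^ m * MvPolynomial.aeval b (MvPolynomial.esymm (Fin k) ℤ m) := by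
  have h := congrArg (MvPolynomial.aeval b) (coeff_eulerProduct_generic k hm)
  rw [map_mul, map_pow, map_neg, map_one] at h
  rw [← h]
  have h1 := congrArg (coeff m) (map_eulerProduct (MvPolynomial.aeval b).toRingHom
    (∑ j, monomialVector fun _ : Fin 1 => (MvPolynomial.X j : MvPolynomial (Fin k) ℤ)) M)
  rw [coeff_map, mapFun_sum_monomialVector] at h1
  refine Eq.trans ?_ h1.symm
  congr 2
  refine Finset.sum_congr rfl fun j _ => ?_
  congr 1
  funext i
  exact (MvPolynomial.aeval_X b j).symm

end EulerProduct

/-! ### Elementary symmetric polynomials -/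

section ElementarySymmetric

open MvPolynomial

variable {R : Type*} [CommRing R] (N : ℕ)

variable (R) in
/-- The coefficient of `T ^ |I|` in `∏_d (1 - x_d T ^ d)`, for indeterminates `x_d`. -/
noncomputable def eulerCoeff (I : Idx 1) : MvPolynomial (Idx 1) R :=
  PowerSeries.coeff I.deg (eulerProduct ⟨X⟩ I.deg)

variable (R) in
/-- The coefficient of `T ^ |I|` in `∏_j (1 - t_j T)`. -/
noncomputable def signedEsymm (I : Idx 1) : MvPolynomial (Fin N × Fin 1) R :=
  (-1) ^ I.deg * rename (fun j => (j, 0)) (esymm (Fin N) R I.deg)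

theorem theta_eulerCoeff (I : Idx 1) : theta 1 N R (eulerCoeff R I) = signedEsymm R N I := by
  have h := congrArg (PowerSeries.coeff I.deg)
    (map_eulerProduct (theta 1 N R).toRingHom ⟨X⟩ I.deg)
  rw [PowerSeries.coeff_map] at h
  refine h.trans ?_
  have h1 : Witt.mapFun (theta 1 N R).toRingHom ⟨X⟩ =
      ∑ j, monomialVector fun _ : Fin 1 => (X (j, 0) : MvPolynomial (Fin N × Fin 1) R) := by
    refine Eq.trans (b := genericSum 1 N R) ?_ ?_
    · ext I : 2
      exact aeval_X _ _
    · refine Finset.sum_congr rfl fun j _ => ?_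
      congr 1
      funext i
      rw [Subsingleton.elim i 0]
  rw [h1, coeff_eulerProduct_sum _ le_rfl, signedEsymm]
  congr 1
  simp [esymm, map_sum, map_prod]

theorem coeff_eulerProduct_mem_weightIdeal (M m : ℕ) :
    PowerSeries.coeff m (eulerProduct (⟨X⟩ : Witt 1 (MvPolynomial (Idx 1) R)) M) ∈
      weightIdeal R Idx.deg m := by
  induction M generalizing m with
  | zero =>
    rw [eulerProduct, Finset.prod_range_zero, PowerSeries.coeff_one]
    split_ifs with h
    · subst h
      exact mem_weightIdeal_zero _
    · exact Ideal.zero_mem _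
  | succ M ih =>
    rw [eulerProduct, Finset.prod_range_succ, ← eulerProduct, mul_sub, mul_one, map_sub,
      ← mul_assoc, PowerSeries.coeff_mul_X_pow', mul_comm]
    refine Ideal.sub_mem _ (ih m) ?_
    split_ifs with h
    · rw [PowerSeries.coeff_C_mul]
      have h1 := X_mem_weightIdeal (R := R) (w := Idx.deg) (Idx.ofSucc M)
      rw [Idx.deg_ofSucc] at h1
      have h2 := mul_mem_weightIdeal h1 (ih (m - (M + 1)))
      rwa [Nat.add_sub_cancel' h] at h2
    · exact Ideal.zero_mem _

/-- The coefficient of `T ^ d` in the product is `-x_d` plus a polynomial in the `x_e` with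
`e < d`, so that the coefficients generate the polynomial ring. -/
theorem X_mem_adjoin_eulerCoeff (I : Idx 1) :
    (X I : MvPolynomial (Idx 1) R) ∈ Algebra.adjoin R (Set.range (eulerCoeff R)) := by
  obtain ⟨d, hd⟩ : ∃ d, I.deg = d + 1 := ⟨I.deg - 1, by have := I.deg_pos; omega⟩
  obtain rfl := Idx.ofSucc_of_deg hd
  clear hd
  induction d using Nat.strong_induction_on with
  | _ d ih =>
    -- all coefficients of a product of factors with smaller indices lie in the subalgebra
    have h1 : ∀ M ≤ d, ∀ m, PowerSeries.coeff m (eulerProduct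
        (⟨X⟩ : Witt 1 (MvPolynomial (Idx 1) R)) M) ∈
          Algebra.adjoin R (Set.range (eulerCoeff R)) := by
      intro M
      induction M with
      | zero =>
        intro _ m
        rw [eulerProduct, Finset.prod_range_zero, PowerSeries.coeff_one]
        split_ifs
        · exact Subalgebra.one_mem _
        · exact Subalgebra.zero_mem _
      | succ M ihM =>
        intro hM m
        rw [eulerProduct, Finset.prod_range_succ, ← eulerProduct, mul_sub, mul_one, map_sub,
          ← mul_assoc, PowerSeries.coeff_mul_X_pow', mul_comm]
        refine Subalgebra.sub_mem _ (ihM (by omega) m) ?_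
        split_ifs
        · rw [PowerSeries.coeff_C_mul]
          exact Subalgebra.mul_mem _ (ih M (by omega)) (ihM (by omega) _)
        · exact Subalgebra.zero_mem _
    have h2 : eulerCoeff R (Idx.ofSucc d) = PowerSeries.coeff (d + 1) (eulerProduct
        (⟨X⟩ : Witt 1 (MvPolynomial (Idx 1) R)) d) - X (Idx.ofSucc d) := by
      rw [eulerCoeff, Idx.deg_ofSucc, eulerProduct, Finset.prod_range_succ, ← eulerProduct,
        mul_sub, mul_one, map_sub, ← mul_assoc, PowerSeries.coeff_mul_X_pow', if_pos le_rfl,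
        Nat.sub_self, mul_comm, PowerSeries.coeff_C_mul]
      congr 1
      rw [PowerSeries.coeff_zero_eq_constantCoeff_apply, eulerProduct, map_prod]
      simp
    rw [eq_sub_iff_add_eq, ← eq_sub_iff_add_eq'] at h2
    rw [h2]
    exact Subalgebra.sub_mem _ (h1 d le_rfl _) (Algebra.subset_adjoin ⟨_, rfl⟩)

theorem signedEsymm_isWeightedHomogeneous (I : Idx 1) :
    (signedEsymm R N I).IsWeightedHomogeneous (fun _ => 1) I.deg := by
  have h : signedEsymm R N I = C ((-1) ^ I.deg) *
      ∑ t ∈ Finset.powersetCard I.deg Finset.univ, ∏ j ∈ t, X (j, 0) := by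
    simp [signedEsymm, esymm, map_sum, map_prod]
  rw [h]
  refine IsWeightedHomogeneous.C_mul (IsWeightedHomogeneous.sum _ _ _ fun t ht => ?_) _
  have h1 := IsWeightedHomogeneous.prod (w := fun _ => 1) t
    (fun j => (X (j, 0) : MvPolynomial (Fin N × Fin 1) R)) (fun _ => 1)
    fun j _ => isWeightedHomogeneous_X R _ _
  rwa [Finset.sum_const, (Finset.mem_powersetCard.1 ht).2, smul_eq_mul, mul_one] at h1

/-- The homomorphism that sends the variable `i` to `± x_{i+1}`. -/
noncomputable def signedVariables : MvPolynomial (Fin N) R →ₐ[R] MvPolynomial (Idx 1) R :=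
  aeval fun i => (-1) ^ (i.1 + 1) * X (Idx.ofSucc i)

theorem aeval_signedEsymm_signedVariables (p : MvPolynomial (Fin N) R) :
    aeval (signedEsymm R N) (signedVariables N p) =
      rename (fun j => (j, 0)) (esymmAlgHom (Fin N) R N p).1 := by
  rw [esymmAlgHom_apply]
  change ((aeval (signedEsymm R N)).comp (signedVariables N)) p =
    ((rename fun j => (j, 0)).comp (aeval fun i : Fin N => esymm (Fin N) R (i + 1))) p
  congr 1
  ext i : 1
  simp only [AlgHom.comp_apply, signedVariables, aeval_X, map_mul, map_pow, map_neg, map_one,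
    signedEsymm, Idx.deg_ofSucc]
  rw [← mul_assoc, ← mul_pow, neg_one_mul, neg_neg, one_pow, one_mul]

theorem exists_aeval_signedEsymm {q : MvPolynomial (Fin N × Fin 1) R}
    (hq : ∀ σ : Equiv.Perm (Fin N), rename (Prod.map σ id) q = q) :
    ∃ p : MvPolynomial (Idx 1) R, aeval (signedEsymm R N) p = q := by
  have hsymm : (rename Prod.fst q : MvPolynomial (Fin N) R).IsSymmetric := by
    intro σ
    conv_rhs => rw [← hq σ]
    rw [rename_rename, rename_rename]
    rfl
  obtain ⟨p, hp⟩ := esymmAlgHom_surjective R (σ := Fin N) (n := N) (by simp)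
    ⟨rename Prod.fst q, hsymm⟩
  refine ⟨signedVariables N p, ?_⟩
  have h : (fun j : Fin N => (j, (0 : Fin 1))) ∘ Prod.fst = id := by
    funext v
    exact Prod.ext rfl (Subsingleton.elim _ _)
  rw [aeval_signedEsymm_signedVariables, hp, rename_rename, h]
  exact rename_id_apply q

/-- The first `N` elementary symmetric polynomials in `N` variables satisfy no relations; the higher
ones vanish, but have weight larger than `N`. -/
theorem mem_weightIdeal_of_aeval_signedEsymm {p : MvPolynomial (Idx 1) R}
    (hp : aeval (signedEsymm R N) p ∈ weightIdeal R (fun _ => 1) N) :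
    p ∈ weightIdeal R Idx.deg N := by
  classical
  obtain ⟨q, hpq, hq⟩ := exists_sub_mem_weightIdeal Idx.deg N p
  have hqw (d) (hd : d ∈ q.support) : Finsupp.weight Idx.deg d < N := by
    by_contra h
    rw [mem_support_iff, hq, if_neg h] at hd
    exact hd rfl
  have hhom (d : Idx 1 →₀ ℕ) : (∏ I ∈ d.support,
      signedEsymm R N I ^ d I).IsWeightedHomogeneous (fun _ => 1) (Finsupp.weight Idx.deg d) := by
    rw [Finsupp.weight_apply]
    exact IsWeightedHomogeneous.prod _ _ _ fun I _ =>
      (signedEsymm_isWeightedHomogeneous N I).pow _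
  have h1 : aeval (signedEsymm R N) q = 0 := by
    ext e
    rw [coeff_zero]
    by_cases he : Finsupp.weight (fun _ => 1) e < N
    · have h2 : aeval (signedEsymm R N) (p - q) ∈ weightIdeal R (fun _ => 1) N :=
        aeval_mem_weightIdeal (fun I => fun d hd =>
          (signedEsymm_isWeightedHomogeneous N I).coeff_eq_zero d hd.ne) hpq
      rw [map_sub] at h2
      have h3 := Ideal.sub_mem _ hp h2
      rw [sub_sub_cancel] at h3
      exact h3 e he
    · rw [aeval_def, eval₂_eq, coeff_sum]
      refine Finset.sum_eq_zero fun d hd => ?_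
      rw [algebraMap_eq, coeff_C_mul, (hhom d).coeff_eq_zero e, mul_zero]
      have := hqw d hd
      omega
  -- a right inverse of `signedVariables` on polynomials of small weight
  let κ : MvPolynomial (Idx 1) R →ₐ[R] MvPolynomial (Fin N) R :=
    aeval fun I => if h : I.deg - 1 < N then (-1) ^ I.deg * X ⟨I.deg - 1, h⟩ else 0
  have h2 : signedVariables N (κ q) = q := by
    change ((signedVariables N).comp κ) q = AlgHom.id R _ q
    have h3 : ((signedVariables N).comp κ).toRingHom.comp C =
        (AlgHom.id R (MvPolynomial (Idx 1) R)).toRingHom.comp C := by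
      ext r : 1
      exact ((signedVariables N).comp κ).commutes r
    refine hom_congr_vars h3 ?_ rfl (f₁ := ((signedVariables N).comp κ).toRingHom)
      (f₂ := (AlgHom.id R (MvPolynomial (Idx 1) R)).toRingHom)
    intro I hI _
    obtain ⟨d, hd, hId⟩ := (mem_vars_iff_mem_support I).1 hI
    have h4 := hqw d hd
    have h5 := Finsupp.le_weight_of_ne_zero' Idx.deg (Finsupp.mem_support_iff.1 hId)
    have h6 := I.deg_pos
    change signedVariables N (κ (X I)) = X I
    rw [aeval_X, dif_pos (by omega), map_mul, map_pow, map_neg, map_one, signedVariables, aeval_X,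
      Nat.sub_add_cancel h6, ← mul_assoc, ← mul_pow, neg_one_mul, neg_neg, one_pow, one_mul,
      Idx.ofSucc_of_deg (Nat.sub_add_cancel h6).symm]
  have h3 := aeval_signedEsymm_signedVariables N (κ q)
  rw [h2, h1] at h3
  have h4 : κ q = 0 := by
    apply esymmAlgHom_injective R (σ := Fin N) (n := N) (by simp)
    rw [map_zero]
    apply Subtype.ext
    apply rename_injective (fun j : Fin N => (j, (0 : Fin 1))) (fun _ _ h => congrArg Prod.fst h)
    rw [← h3]
    exact (map_zero _).symm
  rw [h4, map_zero] at h2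
  rwa [← h2, sub_zero] at hpq

end ElementarySymmetric

/-! ### Witt components as coordinates on symmetric polynomials -/

section SymmetricCoordinates

open MvPolynomial

variable {n N : ℕ} {R : Type*} [CommRing R]

/-- To show that `theta` reflects weights, the variables `x_I` may be replaced by any other system
of generators `E I` of the right weights. -/
theorem mem_weightIdeal_of_theta_of_generators {E : Idx n → MvPolynomial (Idx n) R}
    {s : Idx n → MvPolynomial (Fin N × Fin n) R}
    (hE : ∀ I, E I ∈ weightIdeal R Idx.deg I.deg)
    (hX : ∀ I, X I ∈ Algebra.adjoin R (Set.range E)) (hs : ∀ I, theta n N R (E I) = s I)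
    (ha : ∀ p : MvPolynomial (Idx n) R, aeval s p ∈ weightIdeal R (fun _ => 1) N →
      p ∈ weightIdeal R Idx.deg N) {p : MvPolynomial (Idx n) R}
    (hp : theta n N R p ∈ weightIdeal R (fun _ => 1) N) : p ∈ weightIdeal R Idx.deg N := by
  have hsurj : p ∈ (aeval E : MvPolynomial (Idx n) R →ₐ[R] _).range := by
    rw [← Algebra.adjoin_range_eq_range_aeval]
    have h : (⊤ : Subalgebra R (MvPolynomial (Idx n) R)) ≤ Algebra.adjoin R (Set.range E) := by
      rw [← adjoin_range_X, Algebra.adjoin_le_iff]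
      rintro _ ⟨I, rfl⟩
      exact hX I
    exact h trivial
  obtain ⟨q, rfl⟩ := hsurj
  refine aeval_mem_weightIdeal hE (ha q ?_)
  convert hp using 1
  change _ = theta n N R (aeval E q)
  rw [comp_aeval_apply]
  congr 2
  exact funext fun I => (hs I).symm

theorem exists_theta_eq_aeval {E : Idx n → MvPolynomial (Idx n) R}
    {s : Idx n → MvPolynomial (Fin N × Fin n) R} (hs : ∀ I, theta n N R (E I) = s I)
    (p : MvPolynomial (Idx n) R) : ∃ q, theta n N R q = aeval s p := by
  refine ⟨aeval E p, ?_⟩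
  rw [comp_aeval_apply]
  congr 2
  exact funext hs

theorem theta_ghost (I : Idx n) :
    theta n N R ((⟨X⟩ : Witt n (MvPolynomial (Idx n) R)).ghost I) = powerSum N R I.1 := by
  refine (Witt.ghost_mapFun (theta n N R).toRingHom ⟨X⟩ I).symm.trans ?_
  have h : Witt.mapFun (theta n N R).toRingHom ⟨X⟩ = genericSum n N R := by
    ext I : 2
    exact aeval_X _ _
  rw [h, genericSum, ghost_sum_monomialVector]
  rfl

theorem ghost_mem_weightIdeal (I : Idx n) :
    (⟨X⟩ : Witt n (MvPolynomial (Idx n) R)).ghost I ∈ weightIdeal R Idx.deg I.deg := by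
  refine Ideal.sum_mem _ fun f _ => Ideal.mul_mem_left _ _ ?_
  rw [← f.k_mul_deg]
  exact pow_mem_weightIdeal (X_mem_weightIdeal f.J) f.k

/-- The ghost component with index `I` is `gcd(I) x_I` plus a polynomial in components with smaller
`gcd`, and `gcd(I)` is invertible in characteristic zero. -/
theorem X_mem_adjoin_ghost [Algebra ℚ R] (I : Idx n) :
    (X I : MvPolynomial (Idx n) R) ∈ Algebra.adjoin R
      (Set.range fun I => (⟨X⟩ : Witt n (MvPolynomial (Idx n) R)).ghost I) := by
  classical
  induction hg : I.gcd using Nat.strong_induction_on generalizing I with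
  | _ g ih =>
    subst hg
    obtain ⟨v, hv⟩ :=
      (isUnit_natCast_of_algebra_rat (R := R) I.gcd_pos.ne').exists_left_inv
    have h1 : (X I : MvPolynomial (Idx n) R) =
        v • ((⟨X⟩ : Witt n (MvPolynomial (Idx n) R)).ghost I -
          ∑ f : {f : Factor I // f.k ≠ 1}, (f.1.J.gcd : MvPolynomial (Idx n) R) *
            X f.1.J ^ f.1.k) := by
      rw [Witt.ghost, sum_factor, add_sub_cancel_right]
      change _ = v • ((I.gcd : MvPolynomial (Idx n) R) * X I ^ 1)
      rw [pow_one, ← nsmul_eq_mul, ← Nat.cast_smul_eq_nsmul R, smul_smul, hv, one_smul]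
    rw [h1]
    refine Subalgebra.smul_mem _ (Subalgebra.sub_mem _
      (Algebra.subset_adjoin (Set.mem_range_self I))
      (Subalgebra.sum_mem _ fun f _ => Subalgebra.mul_mem _ (natCast_mem _ _)
        (Subalgebra.pow_mem _ (ih _ (Factor.gcd_lt f.2) _ rfl) _))) _

/-- In degrees below `N`, the components of the sum of `N` generic monomial vectors are
algebraically independent. -/
theorem mem_weightIdeal_of_theta (h : Nonempty (Algebra ℚ R) ∨ n = 1)
    {p : MvPolynomial (Idx n) R} (hp : theta n N R p ∈ weightIdeal R (fun _ => 1) N) :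
    p ∈ weightIdeal R Idx.deg N := by
  rcases h with ⟨⟨_⟩⟩ | rfl
  · exact mem_weightIdeal_of_theta_of_generators ghost_mem_weightIdeal X_mem_adjoin_ghost
      theta_ghost (fun _ => mem_weightIdeal_of_aeval_powerSum) hp
  · exact mem_weightIdeal_of_theta_of_generators
      (fun I => coeff_eulerProduct_mem_weightIdeal I.deg I.deg) X_mem_adjoin_eulerCoeff
      (theta_eulerCoeff N) (fun _ => mem_weightIdeal_of_aeval_signedEsymm N) hp

/-- The polynomials which are invariant under permutations of the `N` points are polynomials in
the components of the sum of the generic monomial vectors. -/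
theorem exists_theta_eq (h : Nonempty (Algebra ℚ R) ∨ n = 1)
    {q : MvPolynomial (Fin N × Fin n) R}
    (hq : ∀ σ : Equiv.Perm (Fin N), rename (Prod.map σ id) q = q) :
    ∃ p, theta n N R p = q := by
  rcases h with ⟨⟨_⟩⟩ | rfl
  · have h1 := mem_adjoin_powerSum hq
    rw [Algebra.adjoin_range_eq_range_aeval] at h1
    obtain ⟨p, rfl⟩ := h1
    exact exists_theta_eq_aeval theta_ghost p
  · obtain ⟨p, rfl⟩ := exists_aeval_signedEsymm N hq
    exact exists_theta_eq_aeval (theta_eulerCoeff N) p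

end SymmetricCoordinates

/-! ### Truncated polynomial rings -/

section Truncation

open MvPolynomial

variable (n N : ℕ) (R : Type*) [CommRing R]

/-- The ring `R[x_I]`, truncated in weights `≥ N`, where `x_I` has weight `|I|`. -/
abbrev TruncWitt : Type _ := MvPolynomial (Idx n) R ⧸ weightIdeal R (Idx.deg (n := n)) N

/-- The ring of polynomials in the coordinates of `N` points of affine `n`-space, truncated in
degrees `≥ N`. -/
abbrev TruncPoints : Type _ :=
  MvPolynomial (Fin N × Fin n) R ⧸ weightIdeal R (fun _ : Fin N × Fin n => 1) N

/-- The homomorphism induced by `theta` on truncations. -/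
noncomputable def thetaTrunc : TruncWitt n N R →ₐ[R] TruncPoints n N R :=
  Ideal.Quotient.liftₐ _ ((Ideal.Quotient.mkₐ R _).comp (theta n N R)) fun _ hp =>
    Ideal.Quotient.eq_zero_iff_mem.2 (theta_mem_weightIdeal n N R hp)

theorem rename_mem_weightIdeal (σ : Equiv.Perm (Fin N)) {M : ℕ}
    {p : MvPolynomial (Fin N × Fin n) R} (hp : p ∈ weightIdeal R (fun _ => 1) M) :
    rename (Prod.map σ id) p ∈ weightIdeal R (fun _ => 1) M := by
  have h : rename (R := R) (Prod.map σ id) = aeval fun v : Fin N × Fin n => X (Prod.map σ id v) :=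
    algHom_ext fun v => by rw [rename_X, aeval_X]
  rw [h]
  exact aeval_mem_weightIdeal (fun _ => X_mem_weightIdeal _) hp

/-- The action of a permutation of the points. -/
noncomputable def permTrunc (σ : Equiv.Perm (Fin N)) : TruncPoints n N R →ₐ[R] TruncPoints n N R :=
  Ideal.Quotient.liftₐ _ ((Ideal.Quotient.mkₐ R _).comp (rename (Prod.map σ id))) fun _ hp =>
    Ideal.Quotient.eq_zero_iff_mem.2 (rename_mem_weightIdeal n N R σ hp)

variable {n R}

theorem thetaTrunc_injective (h : Nonempty (Algebra ℚ R) ∨ n = 1) :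
    Function.Injective (thetaTrunc n N R) := by
  rw [injective_iff_map_eq_zero]
  intro p hp
  obtain ⟨p, rfl⟩ := Ideal.Quotient.mk_surjective p
  exact Ideal.Quotient.eq_zero_iff_mem.2
    (mem_weightIdeal_of_theta h (Ideal.Quotient.eq_zero_iff_mem.1 hp))

/-- Invariants of the truncated ring lift to invariant polynomials, because permutations preserve
degrees; so they come from the truncation of `R[x_I]`. -/
theorem exists_thetaTrunc_eq (h : Nonempty (Algebra ℚ R) ∨ n = 1) (q : TruncPoints n N R)
    (hq : ∀ σ, permTrunc n N R σ q = q) : ∃ p, thetaTrunc n N R p = q := by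
  obtain ⟨q, rfl⟩ := Ideal.Quotient.mk_surjective q
  obtain ⟨q', hqq', hq'⟩ := exists_sub_mem_weightIdeal (fun _ => 1) N q
  -- the part of small degree of a representative is itself invariant
  have hinv (σ : Equiv.Perm (Fin N)) : rename (Prod.map σ id) q' = q' := by
    have h1 : rename (Prod.map σ id) q' - q' ∈ weightIdeal R (fun _ => 1) N := by
      have h2 := Ideal.Quotient.eq.1 (hq σ)
      have h3 := rename_mem_weightIdeal n N R σ hqq'
      rw [map_sub] at h3
      have h4 := Ideal.add_mem _ (Ideal.sub_mem _ h2 h3) hqq'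
      convert h4 using 1
      change _ = rename (Prod.map σ id) q - q - _ + _
      ring
    ext e
    by_cases he : Finsupp.weight (fun _ => 1) e < N
    · have := h1 e he
      rwa [coeff_sub, sub_eq_zero] at this
    · rw [hq', if_neg he]
      by_contra hne
      obtain ⟨d, rfl, hd⟩ := coeff_rename_ne_zero _ _ _ hne
      rw [hq'] at hd
      refine he ?_
      have hd' := (ite_ne_right_iff.1 hd).1
      convert hd' using 1
      rw [Finsupp.weight_apply, Finsupp.weight_apply,
        Finsupp.sum_mapDomain_index (fun _ => by simp) (fun _ _ _ => by simp)]
  obtain ⟨p, hp⟩ := exists_theta_eq h hinv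
  refine ⟨Ideal.Quotient.mk _ p, ?_⟩
  change Ideal.Quotient.mk _ (theta n N R p) = _
  rw [hp]
  exact (Ideal.Quotient.eq.2 hqq').symm

/-- Large weights vanish on nilpotent elements of bounded weight. -/
theorem aeval_eq_zero_of_mem_weightIdeal {τ S B : Type*} [CommRing S] [CommRing B] [Algebra S B]
    {w : τ → ℕ} (b : τ → B) (𝔫 : Ideal B) (hb : ∀ v, b v ∈ 𝔫) (K M : ℕ) (h𝔫 : 𝔫 ^ K = ⊥)
    (hM : ∀ v, M < w v → b v = 0) {m : ℕ} (hm : M * K ≤ m) (hm0 : 0 < m)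
    {p : MvPolynomial τ S} (hp : p ∈ weightIdeal S w m) : aeval b p = 0 := by
  rw [aeval_def, eval₂_eq]
  refine Finset.sum_eq_zero fun d hd => ?_
  have h : m ≤ Finsupp.weight w d := by
    by_contra h
    exact mem_support_iff.1 hd (hp d (not_le.1 h))
  have h1 := aeval_eq_zero_of_homogeneous w (isWeightedHomogeneous_monomial (R := ℤ) w d 1 rfl) b
    𝔫 hb K M h𝔫 hM (hm.trans h) (hm0.trans_le h)
  rw [aeval_monomial, map_one, one_mul, Finsupp.prod] at h1
  rw [h1, mul_zero]

theorem Witt.IsSmall.exists_level {B : Type*} [CommRing B] (S : Type*) [CommRing S] [Algebra S B]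
    {x : Witt n B} (hx : x.IsSmall) :
    ∃ N, ∀ p ∈ weightIdeal S Idx.deg N, aeval x.coeff p = 0 := by
  obtain ⟨𝔫, K, M, h𝔫, hmem, hM⟩ := Witt.IsSmall.exists_bounds (κ := Unit) (x := fun _ => x)
    fun _ => hx
  exact ⟨M * K + 1, fun p hp => aeval_eq_zero_of_mem_weightIdeal x.coeff 𝔫 (hmem ()) K M h𝔫
    (hM ()) (Nat.le_succ _) (Nat.succ_pos _) hp⟩

end Truncation

end MultiWitt

namespace FormalGeometry

open MultiWitt

/-! ### Points of formal groups and curves -/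

section Points

variable {R : Type u} [CommRing R] (G : CommFormalGroup R) {n : ℕ}
  {B C D : Type u} [CommRing B] [CommRing C] [CommRing D] [Algebra R B] [Algebra R C] [Algebra R D]

/-- The group of `B`-points of a commutative formal group. -/
abbrev CommFormalGroup.Points (B : Type u) [CommRing B] [Algebra R B] : Type u :=
  G.obj.obj (CommAlgCat.of R B)

/-- Functoriality of the group of points. -/
def CommFormalGroup.pointsMap (α : B →ₐ[R] C) : G.Points B →+ G.Points C :=
  (G.obj.map (CommAlgCat.ofHom α)).hom

theorem CommFormalGroup.pointsMap_comp (β : C →ₐ[R] D) (α : B →ₐ[R] C) (x : G.Points B) :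
    G.pointsMap (β.comp α) x = G.pointsMap β (G.pointsMap α x) := by
  simp [CommFormalGroup.pointsMap]

theorem CommFormalGroup.pointsMap_injective {α : B →ₐ[R] C} (hα : Function.Injective α) :
    Function.Injective (G.pointsMap α) :=
  IsFormalScheme.map_injective G.property (CommAlgCat.ofHom α) hα

theorem CommFormalGroup.exists_pointsMap_eq {α : B →ₐ[R] C} (hα : Function.Injective α)
    {S : Type*} [Finite S] (s : S → C →ₐ[R] C) (hs : ∀ c, (∀ i, s i c = c) → ∃ b, α b = c)
    (x : G.Points C) (hx : ∀ i, G.pointsMap (s i) x = x) : ∃ y, G.pointsMap α y = x :=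
  IsFormalScheme.exists_of_invariant G.property (CommAlgCat.ofHom α) hα
    (fun i => CommAlgCat.ofHom (s i)) hs x hx

variable (n B) in
/-- The `n`-tuples of nilpotent elements, i.e. the points of formal affine space. -/
abbrev NilTuple : Type u := {b : Fin n → B // ∀ i, IsNilpotent (b i)}

/-- Functoriality of tuples of nilpotent elements. -/
def NilTuple.map (α : B →ₐ[R] C) (b : NilTuple n B) : NilTuple n C :=
  ⟨fun i => α (b.1 i), fun i => (b.2 i).map α⟩

instance : Zero (NilTuple n B) := ⟨⟨0, fun _ => IsNilpotent.zero⟩⟩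

variable (R) in
theorem exists_affinePoint (b : NilTuple n B) :
    ∃ x : (formalAffineSpace R n).X.obj (CommAlgCat.of R B),
      ∀ i, x.1 (MvPowerSeries.X i) = b.1 i := by
  obtain ⟨f, hf, h⟩ := eval_surjective (R := R) (a := b.1) ⟨b.2, Set.toFinite _⟩
  exact ⟨⟨f, hf⟩, h⟩

variable (R) in
/-- The point of formal affine space with given coordinates. -/
noncomputable def affinePoint (b : NilTuple n B) :
    (formalAffineSpace R n).X.obj (CommAlgCat.of R B) :=
  (exists_affinePoint R b).choose

theorem affinePoint_spec (b : NilTuple n B) (i : Fin n) :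
    (affinePoint R b).1 (MvPowerSeries.X i) = b.1 i :=
  (exists_affinePoint R b).choose_spec i

theorem affinePoint_ext {B : CommAlgCat.{u} R} {x y : (formalAffineSpace R n).X.obj B}
    (h : ∀ i, x.1 (MvPowerSeries.X i) = y.1 (MvPowerSeries.X i)) : x = y :=
  Subtype.ext (eval_injective x.2 y.2 h)

/-- The coordinates of a point of formal affine space. -/
noncomputable def affineCoord {B : CommAlgCat.{u} R} (x : (formalAffineSpace R n).X.obj B) :
    NilTuple n B :=
  ⟨fun i => x.1 (MvPowerSeries.X i), (eval_hasEval x.1 x.2).1⟩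

theorem affinePoint_affineCoord {B : CommAlgCat.{u} R} (x : (formalAffineSpace R n).X.obj B) :
    affinePoint R (affineCoord x) = x :=
  affinePoint_ext fun i => affinePoint_spec _ i

variable {G}

/-- The value of a pointed morphism from formal affine space at a tuple of nilpotent elements. -/
noncomputable def curve (f : formalAffineSpace R n ⟶ G.pointed) (b : NilTuple n B) : G.Points B :=
  homApp f (CommAlgCat.of R B) (affinePoint R b)

theorem pointsMap_curve (f : formalAffineSpace R n ⟶ G.pointed) (α : B →ₐ[R] C)
    (b : NilTuple n B) : G.pointsMap α (curve f b) = curve f (b.map α) := by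
  refine (homApp_map f (CommAlgCat.ofHom α) (affinePoint R b)).symm.trans ?_
  refine congrArg (homApp f (CommAlgCat.of R C)) (affinePoint_ext fun i => ?_)
  rw [affinePoint_spec]
  exact congrArg α (affinePoint_spec b i)

theorem curve_zero (f : formalAffineSpace R n ⟶ G.pointed) : curve f (0 : NilTuple n B) = 0 := by
  have h1 : curve f (0 : NilTuple n R) = 0 := by
    refine Eq.trans ?_ (homApp_pt f)
    refine congrArg (homApp f (CommAlgCat.of R R)) (affinePoint_ext fun i => ?_)
    rw [affinePoint_spec]
    exact (MvPowerSeries.constantCoeff_X (R := R) i).symm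
  have h2 := pointsMap_curve f (Algebra.ofId R B) 0
  rw [h1, map_zero] at h2
  rw [h2]
  congr 1
  exact Subtype.ext (funext fun i => (map_zero (Algebra.ofId R B)).symm)

/-- The Witt vector `monomialVector b` as a point of the formal group of `𝕎`. -/
def monomialPoint (b : NilTuple n B) : Witt.small n B :=
  ⟨monomialVector b.1, isSmall_monomialVector b.2⟩

theorem smallMap_monomialPoint (α : B →ₐ[R] C) (b : NilTuple n B) :
    Witt.smallMap α.toRingHom (monomialPoint b) = monomialPoint (b.map α) :=
  Subtype.ext (mapFun_monomialVector α.toRingHom b.1)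

theorem monomialPoint_zero : monomialPoint (0 : NilTuple n B) = 0 := by
  refine Subtype.ext (Witt.ext (funext fun I => ?_))
  change (if I.gcd = 1 then ∏ i, (0 : B) ^ I.1 i else 0) = 0
  obtain ⟨i, hi⟩ : ∃ i, I.1 i ≠ 0 := by
    by_contra! h
    exact I.2 (funext h)
  rw [Finset.prod_eq_zero (Finset.mem_univ i) (zero_pow hi), ite_self]

theorem coe_sum_monomialPoint {k : ℕ} (c : Fin k → NilTuple n B) :
    ((∑ j, monomialPoint (c j) : Witt.small n B) : Witt n B) = ∑ j, monomialVector (c j).1 :=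
  AddSubgroup.val_finsetSum _ _ _

end Points

/-! ### Extension of curves to homomorphisms -/

section Extension

open MvPolynomial

variable {R : Type u} [CommRing R] {G : CommFormalGroup R} {n : ℕ}
  {B C : Type u} [CommRing B] [CommRing C] [Algebra R B] [Algebra R C]

theorem isNilpotent_mk_of_mem_weightIdeal {σ : Type*} {w : σ → ℕ} {N : ℕ} {S : Type*} [CommRing S]
    {p : MvPolynomial σ S} (hp : p ∈ weightIdeal S w 1) :
    IsNilpotent (Ideal.Quotient.mk (weightIdeal S w N) p) := by
  refine ⟨N, ?_⟩
  rw [← map_pow, Ideal.Quotient.eq_zero_iff_mem]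
  simpa using pow_mem_weightIdeal hp N

variable (n) in
/-- The `N` generic points of affine space over the truncated polynomial ring. -/
noncomputable def genericPoint (N : ℕ) (S : Type u) [CommRing S] (j : Fin N) :
    NilTuple n (TruncPoints n N S) :=
  ⟨fun i => Ideal.Quotient.mk _ (X (j, i)),
    fun _ => isNilpotent_mk_of_mem_weightIdeal (X_mem_weightIdeal _)⟩

theorem map_permTrunc_genericPoint {N : ℕ} (σ : Equiv.Perm (Fin N)) (j : Fin N) :
    (genericPoint n N R j).map (permTrunc n N R σ) = genericPoint n N R (σ j) := by
  refine Subtype.ext (_root_.funext fun i => ?_)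
  change Ideal.Quotient.mk _ (rename (Prod.map σ id) (X (j, i))) = _
  rw [rename_X]
  rfl

/-- The sum of the values of a curve at generic points is invariant under permutations, hence
defined over the truncation of `R[x_I]`. -/
theorem exists_pointsMap_thetaTrunc_eq (h : Nonempty (Algebra ℚ R) ∨ n = 1)
    (f : formalAffineSpace R n ⟶ G.pointed) (N : ℕ) :
    ∃ g : G.Points (TruncWitt n N R),
      G.pointsMap (thetaTrunc n N R) g = ∑ j, curve f (genericPoint n N R j) := by
  refine G.exists_pointsMap_eq (thetaTrunc_injective N h) (permTrunc n N R)
    (exists_thetaTrunc_eq N h) _ fun σ => ?_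
  rw [map_sum]
  simp only [pointsMap_curve, map_permTrunc_genericPoint]
  exact Equiv.sum_comp σ fun j => curve f (genericPoint n N R j)

/-- The value at the universal Witt vector `(x_I)_I` of the homomorphism that extends the
curve `f`. -/
noncomputable def universalValue (h : Nonempty (Algebra ℚ R) ∨ n = 1)
    (f : formalAffineSpace R n ⟶ G.pointed) (N : ℕ) : G.Points (TruncWitt n N R) :=
  (exists_pointsMap_thetaTrunc_eq h f N).choose

theorem pointsMap_thetaTrunc_universalValue (h : Nonempty (Algebra ℚ R) ∨ n = 1)
    (f : formalAffineSpace R n ⟶ G.pointed) (N : ℕ) :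
    G.pointsMap (thetaTrunc n N R) (universalValue h f N) =
      ∑ j, curve f (genericPoint n N R j) :=
  (exists_pointsMap_thetaTrunc_eq h f N).choose_spec

/-- Evaluation of truncated polynomials at the components of a Witt vector. -/
noncomputable def evalWitt (S : Type*) [CommRing S] [Algebra S B] (x : Witt n B) (N : ℕ)
    (hx : ∀ p ∈ weightIdeal S Idx.deg N, aeval x.coeff p = 0) : TruncWitt n N S →ₐ[S] B :=
  Ideal.Quotient.liftₐ _ (aeval x.coeff) hx

/-- Evaluation of truncated polynomials at `N` points of affine space. -/
noncomputable def evalPoints {N : ℕ} (c : Fin N → NilTuple n B)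
    (hc : ∀ p ∈ weightIdeal R (fun _ => 1) N,
      aeval (fun v : Fin N × Fin n => (c v.1).1 v.2) p = 0) : TruncPoints n N R →ₐ[R] B :=
  Ideal.Quotient.liftₐ _ (aeval fun v : Fin N × Fin n => (c v.1).1 v.2) hc

theorem map_evalPoints_genericPoint {N : ℕ} (c : Fin N → NilTuple n B)
    (hc : ∀ p ∈ weightIdeal R (fun _ => 1) N,
      aeval (fun v : Fin N × Fin n => (c v.1).1 v.2) p = 0) (j : Fin N) :
    (genericPoint n N R j).map (evalPoints c hc) = c j :=
  Subtype.ext (_root_.funext fun i => aeval_X _ (j, i))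

theorem aeval_theta {N : ℕ} (c : Fin N → NilTuple n B) (p : MvPolynomial (Idx n) R) :
    aeval (fun v : Fin N × Fin n => (c v.1).1 v.2) (theta n N R p) =
      aeval (∑ j, monomialPoint (c j) : Witt.small n B).1.coeff p := by
  rw [theta, comp_aeval_apply]
  congr 2
  have h := mapFun_sum_monomialVector
    (aeval fun v : Fin N × Fin n => (c v.1).1 v.2 :
      MvPolynomial (Fin N × Fin n) R →ₐ[R] B).toRingHom
    fun j i => X (j, i)
  apply _root_.funext
  intro I
  refine (congrArg (fun t : Witt n B => t.coeff I) h).trans ?_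
  rw [coe_sum_monomialPoint]
  refine congrArg (fun t : Witt n B => t.coeff I) (Finset.sum_congr rfl fun j _ => ?_)
  exact congrArg monomialVector (_root_.funext fun i => aeval_X _ (j, i))

theorem pointsMap_evalWitt_sum (h : Nonempty (Algebra ℚ R) ∨ n = 1)
    (f : formalAffineSpace R n ⟶ G.pointed) {N : ℕ} (c : Fin N → NilTuple n B)
    (hc : ∀ p ∈ weightIdeal R (fun _ => 1) N,
      aeval (fun v : Fin N × Fin n => (c v.1).1 v.2) p = 0)
    (hx : ∀ p ∈ weightIdeal R Idx.deg N,
      aeval (∑ j, monomialPoint (c j) : Witt.small n B).1.coeff p = 0) :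
    G.pointsMap (evalWitt R _ N hx) (universalValue h f N) = ∑ j, curve f (c j) := by
  have h1 : evalWitt R _ N hx = (evalPoints c hc).comp (thetaTrunc n N R) := by
    refine Ideal.Quotient.algHom_ext _ (AlgHom.ext fun p => ?_)
    exact (aeval_theta c p).symm
  rw [h1, G.pointsMap_comp, pointsMap_thetaTrunc_universalValue, map_sum]
  simp only [pointsMap_curve, map_evalPoints_genericPoint]

theorem aeval_sum_monomialPoint_eq_zero {N : ℕ} (c : Fin N → NilTuple n B)
    (hc : ∀ p ∈ weightIdeal R (fun _ => 1) N,
      aeval (fun v : Fin N × Fin n => (c v.1).1 v.2) p = 0) :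
    ∀ p ∈ weightIdeal R Idx.deg N,
      aeval (∑ j, monomialPoint (c j) : Witt.small n B).1.coeff p = 0 := fun p hp => by
  rw [← aeval_theta]
  exact hc _ (theta_mem_weightIdeal n N R hp)

/-- A family of `k` points, continued by zero. -/
def extendZero {M : Type*} [Zero M] {k : ℕ} (c : Fin k → M) (N : ℕ) (j : Fin N) : M :=
  if h : j.1 < k then c ⟨j, h⟩ else 0

theorem sum_extendZero {M M' : Type*} [Zero M] [AddCommMonoid M'] {k N : ℕ} (hkN : k ≤ N)
    (c : Fin k → M) (F : M → M') (hF : F 0 = 0) :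
    ∑ j, F (extendZero c N j) = ∑ j, F (c j) := by
  obtain ⟨l, rfl⟩ := Nat.exists_eq_add_of_le hkN
  rw [Fin.sum_univ_add]
  simp [extendZero, hF]

/-- The values at the universal Witt vectors are compatible with truncation: setting the superfluous
generic points to zero does not change the sums that define them. -/
theorem pointsMap_factor_universalValue (h : Nonempty (Algebra ℚ R) ∨ n = 1)
    (f : formalAffineSpace R n ⟶ G.pointed) {M N : ℕ} (hMN : M ≤ N) :
    G.pointsMap (Ideal.Quotient.factorₐ R (weightIdeal_anti hMN)) (universalValue h f N) =
      universalValue h f M := by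
  apply G.pointsMap_injective (thetaTrunc_injective M h)
  rw [pointsMap_thetaTrunc_universalValue, ← G.pointsMap_comp]
  let c := extendZero (genericPoint n M R) N
  have hc : ∀ p ∈ weightIdeal R (fun _ => 1) N,
      aeval (fun v : Fin N × Fin n => (c v.1).1 v.2) p = 0 := by
    intro p hp
    let b : Fin N × Fin n → MvPolynomial (Fin M × Fin n) R := fun v =>
      if h : v.1.1 < M then X (⟨v.1, h⟩, v.2) else 0
    have h1 : aeval b p ∈ weightIdeal R (fun _ => 1) M := by
      refine weightIdeal_anti hMN (aeval_mem_weightIdeal (fun v => ?_) hp)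
      change (if h : _ then _ else _) ∈ _
      split_ifs
      · exact X_mem_weightIdeal _
      · exact Ideal.zero_mem _
    rw [← Ideal.Quotient.eq_zero_iff_mem] at h1
    rw [← h1]
    change _ = (Ideal.Quotient.mkₐ R _) (aeval b p)
    rw [comp_aeval_apply]
    congr 2
    apply _root_.funext
    intro v
    change (dite _ _ _ : NilTuple n (TruncPoints n M R)).1 v.2 = Ideal.Quotient.mk _ (dite _ _ _)
    split_ifs
    · rfl
    · exact (map_zero _).symm
  have h1 : (thetaTrunc n M R).comp (Ideal.Quotient.factorₐ R (weightIdeal_anti hMN)) =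
      evalWitt R _ N (aeval_sum_monomialPoint_eq_zero c hc) := by
    refine Ideal.Quotient.algHom_ext _ (algHom_ext fun I => ?_)
    change Ideal.Quotient.mk _ (theta n M R (X I)) = aeval _ (X I)
    rw [aeval_X, sum_extendZero hMN _ monomialPoint monomialPoint_zero, coe_sum_monomialPoint,
      theta, aeval_X]
    exact congrArg (fun t : Witt n _ => t.coeff I) (mapFun_sum_monomialVector
      (Ideal.Quotient.mk (weightIdeal R (fun _ => 1) M)) fun j i => X (j, i))
  rw [h1, pointsMap_evalWitt_sum h f c hc, sum_extendZero hMN _ _ (curve_zero f)]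

/-- The extension of the curve `f` to the formal group of `𝕎`. -/
noncomputable def extend (h : Nonempty (Algebra ℚ R) ∨ n = 1)
    (f : formalAffineSpace R n ⟶ G.pointed) (x : Witt.small n B) : G.Points B :=
  G.pointsMap (evalWitt R x.1 _ (Witt.IsSmall.exists_level R x.2).choose_spec)
    (universalValue h f (Witt.IsSmall.exists_level R x.2).choose)

/-- The extension may be computed at any level of truncation at which it makes sense. -/
theorem extend_eq (h : Nonempty (Algebra ℚ R) ∨ n = 1)
    (f : formalAffineSpace R n ⟶ G.pointed) (x : Witt.small n B) {N : ℕ}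
    (hN : ∀ p ∈ weightIdeal R Idx.deg N, aeval x.1.coeff p = 0) :
    extend h f x = G.pointsMap (evalWitt R x.1 N hN) (universalValue h f N) := by
  have key : ∀ {M N : ℕ} (hMN : M ≤ N)
      (hM : ∀ p ∈ weightIdeal R Idx.deg M, aeval x.1.coeff p = 0)
      (hN : ∀ p ∈ weightIdeal R Idx.deg N, aeval x.1.coeff p = 0),
      G.pointsMap (evalWitt R x.1 M hM) (universalValue h f M) =
        G.pointsMap (evalWitt R x.1 N hN) (universalValue h f N) := by
    intro M N hMN hM hN
    rw [← pointsMap_factor_universalValue h f hMN, ← G.pointsMap_comp]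
    congr 2
    exact Ideal.Quotient.algHom_ext _ rfl
  rw [extend]
  rcases le_total N (Witt.IsSmall.exists_level R x.2).choose with hle | hle
  · exact (key hle _ _).symm
  · exact key hle _ _

theorem pointsMap_extend (h : Nonempty (Algebra ℚ R) ∨ n = 1)
    (f : formalAffineSpace R n ⟶ G.pointed) (α : B →ₐ[R] C) (x : Witt.small n B) :
    G.pointsMap α (extend h f x) = extend h f (Witt.smallMap α.toRingHom x) := by
  obtain ⟨N, hN⟩ := Witt.IsSmall.exists_level R x.2
  have h1 (p : MvPolynomial (Idx n) R) :
      aeval (Witt.smallMap α.toRingHom x).1.coeff p = α (aeval x.1.coeff p) := by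
    rw [comp_aeval_apply]
    rfl
  have hN' : ∀ p ∈ weightIdeal R Idx.deg N,
      aeval (Witt.smallMap α.toRingHom x).1.coeff p = 0 := fun p hp => by
    rw [h1, hN p hp, map_zero]
  rw [extend_eq h f x hN, extend_eq h f _ hN', ← G.pointsMap_comp]
  congr 2
  refine Ideal.Quotient.algHom_ext _ (AlgHom.ext fun p => ?_)
  exact (h1 p).symm

theorem extend_sum_monomialPoint (h : Nonempty (Algebra ℚ R) ∨ n = 1)
    (f : formalAffineSpace R n ⟶ G.pointed) {k : ℕ} (c : Fin k → NilTuple n B) :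
    extend h f (∑ j, monomialPoint (c j)) = ∑ j, curve f (c j) := by
  -- a nilpotent ideal that contains all coordinates of the given points
  obtain ⟨K, hK⟩ : IsNilpotent (Ideal.span (Set.range fun v : Fin k × Fin n => (c v.1).1 v.2)) := by
    refine (Ideal.FG.isNilpotent_iff_le_nilradical
      (Submodule.fg_span (Set.finite_range _))).2 ?_
    rw [Ideal.span_le]
    rintro _ ⟨v, rfl⟩
    exact (c v.1).2 v.2
  let N := k + K + 1
  have hkN : k ≤ N := by omega
  have hc : ∀ p ∈ weightIdeal R (fun _ => 1) N,
      aeval (fun v : Fin N × Fin n => (extendZero c N v.1).1 v.2) p = 0 := by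
    intro p hp
    refine aeval_eq_zero_of_mem_weightIdeal _ _ (fun v => ?_) K 1 hK
      (fun v hv => absurd hv (lt_irrefl _)) (by omega) (by omega) hp
    change (dite _ _ _ : NilTuple n B).1 v.2 ∈ _
    split_ifs with hv
    · exact Ideal.subset_span ⟨(⟨v.1, hv⟩, v.2), rfl⟩
    · exact Ideal.zero_mem _
  rw [← sum_extendZero hkN c monomialPoint monomialPoint_zero,
    extend_eq h f _ (aeval_sum_monomialPoint_eq_zero _ hc), pointsMap_evalWitt_sum h f _ hc,
    sum_extendZero hkN c _ (curve_zero f)]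

/-- Every point of the formal group of `𝕎` is the image of a point which becomes a sum of vectors
`monomialVector c_j` after an injective base change. -/
theorem exists_splitting (h : Nonempty (Algebra ℚ R) ∨ n = 1) (x : Witt.small n B) :
    ∃ (B' C : CommAlgCat.{u} R) (i : B →ₐ[R] B') (π : B' →ₐ[R] B) (ι : B' →ₐ[R] C)
      (x' : Witt.small n B') (k : ℕ) (c : Fin k → NilTuple n C),
      π.comp i = AlgHom.id R B ∧ Function.Injective ι ∧ Witt.smallMap π.toRingHom x' = x ∧
      Witt.smallMap ι.toRingHom x' = ∑ j, monomialPoint (c j) := by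
  obtain ⟨N, hN⟩ := Witt.IsSmall.exists_level B x.2
  have hB : Nonempty (Algebra ℚ B) ∨ n = 1 := by
    refine h.imp_left ?_
    rintro ⟨_⟩
    exact ⟨((algebraMap R B).comp (algebraMap ℚ R)).toAlgebra⟩
  refine ⟨CommAlgCat.of R (TruncWitt n N B), CommAlgCat.of R (TruncPoints n N B),
    (Algebra.ofId B (TruncWitt n N B)).restrictScalars R, (evalWitt B x.1 N hN).restrictScalars R,
    (thetaTrunc n N B).restrictScalars R, ⟨⟨fun I => Ideal.Quotient.mk _ (X I)⟩, ?_, ?_⟩, N,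
    genericPoint n N B, ?_, thetaTrunc_injective N hB, ?_, ?_⟩
  · exact fun I => isNilpotent_mk_of_mem_weightIdeal
      (weightIdeal_anti I.deg_pos (X_mem_weightIdeal I))
  · refine (Idx.finite_deg_le n N).subset fun I hI => ?_
    by_contra hlt
    exact hI (Ideal.Quotient.eq_zero_iff_mem.2
      (weightIdeal_anti (not_le.1 hlt).le (X_mem_weightIdeal I)))
  · ext b
    exact (evalWitt B x.1 N hN).commutes b
  · refine Subtype.ext (Witt.ext (_root_.funext fun I => ?_))
    exact aeval_X x.1.coeff I
  · refine Subtype.ext (Witt.ext (_root_.funext fun I => ?_))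
    rw [coe_sum_monomialPoint]
    change Ideal.Quotient.mk _ (theta n N B (X I)) = _
    rw [theta, aeval_X]
    exact congrArg (fun t : Witt n _ => t.coeff I) (mapFun_sum_monomialVector
      (Ideal.Quotient.mk (weightIdeal B (fun _ => 1) N)) fun j i => X (j, i))

theorem smallMap_comp {D : Type u} [CommRing D] [Algebra R D] (β : C →ₐ[R] D) (α : B →ₐ[R] C)
    (x : Witt.small n B) : Witt.smallMap β.toRingHom (Witt.smallMap α.toRingHom x) =
      Witt.smallMap (β.comp α).toRingHom x := rfl

/-- A natural family of functions of a point of the formal group of `𝕎` and of further data is zero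
if it is zero at all sums of vectors `monomialVector c_j`. -/
theorem eq_zero_of_eq_zero_sum (h : Nonempty (Algebra ℚ R) ∨ n = 1)
    {Y : CommAlgCat.{u} R → Type*} (t : ∀ {B C : CommAlgCat.{u} R}, (B →ₐ[R] C) → Y B → Y C)
    (ht : ∀ {B C : CommAlgCat.{u} R} (i : B →ₐ[R] C) (π : C →ₐ[R] B),
      π.comp i = AlgHom.id R B → ∀ y, t π (t i y) = y)
    (D : ∀ B : CommAlgCat.{u} R, Witt.small n B → Y B → G.Points B)
    (hD : ∀ {B C : CommAlgCat.{u} R} (α : B →ₐ[R] C) (x : Witt.small n B) (y : Y B),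
      G.pointsMap α (D B x y) = D C (Witt.smallMap α.toRingHom x) (t α y))
    (h0 : ∀ (C : CommAlgCat.{u} R) (k : ℕ) (c : Fin k → NilTuple n C) (y : Y C),
      D C (∑ j, monomialPoint (c j)) y = 0)
    (B : CommAlgCat.{u} R) (x : Witt.small n B) (y : Y B) : D B x y = 0 := by
  obtain ⟨B', C, i, π, ι, x', k, c, hi, hι, rfl, hc⟩ := exists_splitting h x
  rw [← ht i π hi y, ← hD]
  suffices h1 : D B' x' (t i y) = 0 by rw [h1, map_zero]
  apply G.pointsMap_injective hι
  rw [hD, hc, h0, map_zero]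

theorem extend_sum_monomialPoint_add (h : Nonempty (Algebra ℚ R) ∨ n = 1)
    (f : formalAffineSpace R n ⟶ G.pointed) {k l : ℕ} (c : Fin k → NilTuple n B)
    (d : Fin l → NilTuple n B) :
    extend h f (∑ j, monomialPoint (c j) + ∑ j, monomialPoint (d j)) =
      extend h f (∑ j, monomialPoint (c j)) + extend h f (∑ j, monomialPoint (d j)) := by
  have h1 := extend_sum_monomialPoint h f (Fin.append c d)
  simp only [Fin.sum_univ_add, Fin.append_left, Fin.append_right] at h1
  rw [h1, extend_sum_monomialPoint, extend_sum_monomialPoint]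

theorem extend_add (h : Nonempty (Algebra ℚ R) ∨ n = 1)
    (f : formalAffineSpace R n ⟶ G.pointed) (B : CommAlgCat.{u} R) (x y : Witt.small n B) :
    extend h f (x + y) = extend h f x + extend h f y := by
  -- reduce to sums of monomial vectors, first in `x`, then in `y`
  rw [← sub_eq_zero]
  refine eq_zero_of_eq_zero_sum h (Y := fun B => Witt.small n B)
    (fun α => Witt.smallMap α.toRingHom) (fun i π hi y => ?_)
    (fun B x y => extend h f (x + y) - (extend h f x + extend h f y)) (fun α x y => ?_) ?_ B x y
  · rw [smallMap_comp, hi]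
    rfl
  · rw [map_sub, map_add, pointsMap_extend, pointsMap_extend, pointsMap_extend, map_add]
  intro C k c y
  rw [add_comm, add_comm (extend h f _)]
  refine eq_zero_of_eq_zero_sum h (Y := fun B => Fin k → NilTuple n B)
    (fun α c j => (c j).map α) (fun i π hi c => ?_)
    (fun B x c => extend h f (x + ∑ j, monomialPoint (c j)) -
      (extend h f x + extend h f (∑ j, monomialPoint (c j)))) (fun α x c => ?_) ?_ C y c
  · exact _root_.funext fun j =>
      Subtype.ext (_root_.funext fun l => AlgHom.congr_fun hi ((c j).1 l))
  · simp only [map_sub, map_add, pointsMap_extend, map_sum, smallMap_monomialPoint]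
  · intro C l d c
    rw [extend_sum_monomialPoint_add, sub_self]

/-- The extension of a curve as a homomorphism of formal groups. -/
noncomputable def extendHom (h : Nonempty (Algebra ℚ R) ∨ n = 1)
    (f : formalAffineSpace R n ⟶ G.pointed) : wittFormalGroup n R ⟶ G :=
  ObjectProperty.homMk
    { app := fun B => AddCommGrpCat.ofHom
        (AddMonoidHom.mk' (extend (B := B) h f) (extend_add h f B))
      naturality := fun B C φ => by
        ext x
        exact (pointsMap_extend h f φ.hom x).symm }

variable (n R) in
/-- The universal curve `b ↦ monomialVector b`. -/
noncomputable def universalCurve : formalAffineSpace R n ⟶ (wittFormalGroup n R).pointed :=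
  mkHom (fun _ x => monomialPoint (affineCoord x))
    (fun _ _ φ x => (smallMap_monomialPoint φ.hom (affineCoord x)).symm) (by
      refine (congrArg monomialPoint ?_).trans monomialPoint_zero
      exact Subtype.ext (_root_.funext fun i => MvPowerSeries.constantCoeff_X (R := R) i))

/-- Restriction of homomorphisms along the universal curve. -/
noncomputable def restrict (G : CommFormalGroup R) :
    (wittFormalGroup n R ⟶ G) →+ (formalAffineSpace R n ⟶ G.pointed) where
  toFun φ := universalCurve R n ≫ CommFormalGroup.pointedMap φ
  map_zero' := rfl
  map_add' _ _ := rfl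

theorem restrict_injective (h : Nonempty (Algebra ℚ R) ∨ n = 1) (G : CommFormalGroup R) :
    Function.Injective (restrict (n := n) G) := by
  rw [injective_iff_map_eq_zero]
  intro φ hφ
  have h1 (B : CommAlgCat.{u} R) (x : Witt.small n B) : (φ.hom.app B).hom x = 0 := by
    refine eq_zero_of_eq_zero_sum h (Y := fun _ => Unit) (fun _ y => y) (fun _ _ _ _ => rfl)
      (fun B x _ => (φ.hom.app B).hom x) (fun α x _ => ?_) (fun C k c _ => ?_) B x ()
    · exact (NatTrans.naturality_apply φ.hom (CommAlgCat.ofHom α) x).symm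
    · refine (map_sum (φ.hom.app C).hom _ _).trans (Finset.sum_eq_zero fun j _ => ?_)
      have h2 := congrArg (fun f => homApp f C (affinePoint R (c j))) hφ
      have h3 : affineCoord (affinePoint R (c j)) = c j :=
        Subtype.ext (_root_.funext fun i => affinePoint_spec (c j) i)
      change (φ.hom.app C).hom (monomialPoint (affineCoord (affinePoint R (c j)))) = 0 at h2
      rwa [h3] at h2
  ext B x
  exact h1 B x

theorem restrict_surjective (h : Nonempty (Algebra ℚ R) ∨ n = 1) (G : CommFormalGroup R) :
    Function.Surjective (restrict (n := n) G) := by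
  intro f
  refine ⟨extendHom h f, hom_ext' fun B x => ?_⟩
  change extend h f (monomialPoint (affineCoord x)) = _
  have h1 := extend_sum_monomialPoint h f fun _ : Fin 1 => affineCoord x
  rw [Fin.sum_univ_one, Fin.sum_univ_one] at h1
  rw [h1]
  exact congrArg (homApp f B) (affinePoint_affineCoord x)

end Extension

end FormalGeometry

theorem mainTheorem1 {R : Type u} [CommRing R] (n : ℕ)
    (h : Nonempty (Algebra ℚ R) ∨ n = 1) :
    Nonempty (preadditiveCoyoneda.obj (Opposite.op (FormalGeometry.wittFormalGroup n R)) ≅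
      FormalGeometry.morFs (FormalGeometry.formalAffineSpace R n)) := by
  refine ⟨NatIso.ofComponents (fun G => (AddEquiv.ofBijective (FormalGeometry.restrict G)
    ⟨FormalGeometry.restrict_injective h G,
      FormalGeometry.restrict_surjective h G⟩).toAddCommGrpIso) fun {G H} φ => ?_⟩
  ext ψ
  rfl
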